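/- Let $p>1$ and $0<q<\min\{p-1,m\}$ ($p,q,m$ real, dimension $d=1$). Put $$\theta=\frac{p(m-q)}{(m+1)[p+(p-1)(q+1)]},\quad \ell=\frac{m-q}{(m+1)[(p-1)(q+1)+p]},\quad \eta_1=(p-1)(m+1)+p,\quad \eta_2=(p-1)(q+1)+p,$$ let $\mathcal B(a,b)$ be the Beta function and let $B^{-1}(\cdot;a,b)$ be the inverse of the incomplete Beta function $x\mapsto B(x;a,b)=\int_0^x t^{a-1}(1-t)^{b-1}\,dt$ on $[0,1]$. (1) There is exactly one function $u_{c,m}:\mathbb R\to[0,\infty)$ that is even, non-increasing on $[0,\infty)$, lies in $L^{q+1}(\mathbb R)$ with weak derivative in $L^p(\mathbb R)$, and for which there is $R\in(0,\infty)$ such that $u=u_{c,m}$ satisfies $u>0$ on $[0,R)$, $u=0$ on $[R,\infty)$ and solves the free boundary problem $$(|u'|^{p-2}u')'+u^m=u^q\ \text{ for } 0<r<R,\qquad u'(0)=0,\quad u(R)=u'(R)=0 .$$ (2) This solution is given by $$u_{c,m}(r)=\left(\frac{m+1}{q+1}\,B^{-1}\!\left(\bar C(R-r);\frac{p-1-q}{p(m-q)},1-\frac1p\right)\right)^{\frac1{m-q}},\qquad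 0\le r\le R,$$ where $$R=\left(\frac{p-1}{p}\right)^{\frac1p}\frac{(m+1)^{\frac{p-q-1}{p(m-q)}}(q+1)^{\frac1p-\frac{p-q-1}{p(m-q)}}}{m-q}\,\mathcal B\!\left(1-\frac1p,\frac{p-(q+1)}{p(m-q)}\right),$$ $$\bar C=\left(\frac p{p-1}\right)^{\frac1p}(m-q)(m+1)^{\frac{1+q-p}{p(m-q)}}(q+1)^{\frac{p-m-1}{p(m-q)}},$$ and $u_{c,m}(0)=\left(\frac{m+1}{q+1}\right)^{\frac1{m-q}}$. (3) The smallest constant $C_{q,m,p}\ge 0$ such that every $u\in L^{q+1}(\mathbb R)$ with weak derivative $u'\in L^p(\mathbb R)$ lies in $L^{m+1}(\mathbb R)$ and satisfies $\|u\|_{L^{m+1}}\le C_{q,m,p}\|u\|_{L^{q+1}}^{1-\theta}\|u'\|_{L^p}^{\theta}$ exists and equals $$C_{q,m,p}=\theta^{-\frac\theta p}(1-\theta)^{\frac\theta p-\frac1{m+1}}\left(\int_{\mathbb R}u_{c,m}^{q+1}\,dx\right)^{-\theta}=\left(\frac{2^p(p-1)^{1-p}\eta_1^{\frac{\eta_1}{m-q}}}{(m-q)^{2p-1}\eta_2^{\frac{\eta_2}{m-q}}}\,\mathcal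 B\!\left(\frac{\eta_2}{p(m-q)},\frac{2p-1}{p}\right)^p\right)^{-\ell}.$$ -/

import Mathlib

open MeasureTheory Set
open scoped ContDiff ENNReal

noncomputable section

namespace NagyGN

/-- `g` is the weak (distributional) derivative of `u` on the real line. -/
def HasWeakDeriv (u g : ℝ → ℝ) : Prop :=
  LocallyIntegrable u volume ∧ LocallyIntegrable g volume ∧
    ∀ φ : ℝ → ℝ, ContDiff ℝ ∞ φ → HasCompactSupport φ →
      ∫ x, u x * deriv φ x = -∫ x, g x * φ x

/-- `u ∈ L^{q+1}(ℝ)` with weak derivative `g ∈ L^p(ℝ)`. -/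
def MemX (p q : ℝ) (u g : ℝ → ℝ) : Prop :=
  MemLp u (ENNReal.ofReal (q + 1)) volume ∧ HasWeakDeriv u g ∧
    MemLp g (ENNReal.ofReal p) volume

/-- The non-negative, radially symmetric, radially non-increasing elements of
`{u ∈ L^{q+1}(ℝ) : u' ∈ L^p(ℝ)}`. -/
def MemXRad (p q : ℝ) (u : ℝ → ℝ) : Prop :=
  (∀ x, 0 ≤ u x) ∧ (∀ x, u x = u |x|) ∧ AntitoneOn u (Ici 0) ∧ ∃ g, MemX p q u g

/-- `u` is a radially non-increasing solution of the one-dimensional free boundary problem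
`(|u'|^{p-2} u')' + u^m = u^q` on `0 < r < R`, `u'(0) = 0`, `u(R) = u'(R) = 0`,
`u = 0` for `r ≥ R`; here `R ∈ (0, ∞)` is the first zero of `u`. -/
structure IsFreeBoundarySolution (p q m : ℝ) (u : ℝ → ℝ) (R : ℝ) : Prop where
  radius_pos : 0 < R
  mem : MemXRad p q u
  pos : ∀ r ∈ Ico 0 R, 0 < u r
  zero : ∀ r, R ≤ r → u r = 0
  differentiable : ∀ r ∈ Ioo 0 R, DifferentiableAt ℝ u r
  equation : ∀ r ∈ Ioo 0 R,
    DifferentiableAt ℝ (fun s => |deriv u s| ^ (p - 2) * deriv u s) r ∧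
      deriv (fun s => |deriv u s| ^ (p - 2) * deriv u s) r + u r ^ m = u r ^ q
  deriv_origin : HasDerivAt u 0 0
  deriv_radius : HasDerivAt u 0 R

/-- The incomplete Beta function `B(x; a, b)`. -/
def incBeta (x a b : ℝ) : ℝ := ∫ t in (0 : ℝ)..x, t ^ (a - 1) * (1 - t) ^ (b - 1)

/-- The inverse `B⁻¹(y; a, b)` of `x ↦ B(x; a, b)` on `[0, 1]`. -/
def incBetaInv (y a b : ℝ) : ℝ := Function.invFunOn (fun x => incBeta x a b) (Icc 0 1) y

/-- The interpolation exponent `θ` in dimension one. -/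
def theta (p q m : ℝ) : ℝ := p * (m - q) / ((m + 1) * (p + (p - 1) * (q + 1)))

/-- The constants `C` for which `‖u‖_{m+1} ≤ C ‖u‖_{q+1}^{1-θ} ‖u'‖_p^θ` holds for all real
`u ∈ L^{q+1}(ℝ)` with `u' ∈ L^p(ℝ)`. The right-hand side being finite, this includes
`u ∈ L^{m+1}(ℝ)`. -/
def gnConstants (p q m : ℝ) : Set ℝ :=
  {C | 0 ≤ C ∧ ∀ u g : ℝ → ℝ, MemX p q u g →
    eLpNorm u (ENNReal.ofReal (m + 1)) volume ≤
      ENNReal.ofReal C * eLpNorm u (ENNReal.ofReal (q + 1)) volume ^ (1 - theta p q m) *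
        eLpNorm g (ENNReal.ofReal p) volume ^ theta p q m}

/-- The support radius `R`. -/
def radius (p q m : ℝ) : ℝ :=
  ((p - 1) / p) ^ (1 / p) *
    ((m + 1) ^ ((p - q - 1) / (p * (m - q))) *
      (q + 1) ^ (1 / p - (p - q - 1) / (p * (m - q))) / (m - q)) *
    ProbabilityTheory.beta (1 - 1 / p) ((p - (q + 1)) / (p * (m - q)))

/-- The constant `C̄`. -/
def cBar (p q m : ℝ) : ℝ :=
  (p / (p - 1)) ^ (1 / p) * (m - q) * (m + 1) ^ ((1 + q - p) / (p * (m - q))) *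
    (q + 1) ^ ((p - m - 1) / (p * (m - q)))

def eta1 (p m : ℝ) : ℝ := (p - 1) * (m + 1) + p

def eta2 (p q : ℝ) : ℝ := (p - 1) * (q + 1) + p

def ell (p q m : ℝ) : ℝ := (m - q) / ((m + 1) * ((p - 1) * (q + 1) + p))

/-- The explicit value of the best constant. -/
def nagyConstant (p q m : ℝ) : ℝ :=
  (2 ^ p * (p - 1) ^ (1 - p) * eta1 p m ^ (eta1 p m / (m - q)) /
      ((m - q) ^ (2 * p - 1) * eta2 p q ^ (eta2 p q / (m - q))) *
    ProbabilityTheory.beta (eta2 p q / (p * (m - q))) ((2 * p - 1) / p) ^ p) ^ (-ell p q m)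

end NagyGN

end

/-!
Multiplying `(|u'|^{p-2} u')' + u^m = u^q` by `u'` shows that `(p-1)/p |u'|^p - V(u)` is constant,
where `V(t) = t^{q+1}/(q+1) - t^{m+1}/(m+1)`, and the constant is `0` because `u` and `u'` vanish
together at the free boundary. Hence `u` starts at the positive zero `peak` of `V` and decreases
with speed `|u'| = S(u)`, `S = (p/(p-1) V)^{1/p}`; separating variables, the distance to the free
boundary is `∫_0^u dt/S(t)`, which the substitution `s = (t/peak)^{m-q}` turns into an incomplete
Beta function. This gives existence, uniqueness and the formula for the solution.

For the inequality let `w = S^{p-1}`, the momentum. Any `v` that attains `peak` in absolute value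
satisfies `2 ∫_0^peak w ≤ ∫ w(v) |v'| ≤ ‖w(v)‖_{p/(p-1)} ‖v'‖_p` by Hölder, and
`∫ w(v)^{p/(p-1)} = p/(p-1) ∫ V(v)` is a combination of the two norms of `v`. Weighted AM-GM turns
this into the scale-invariant inequality, multiplication by a constant removes the condition on the
height, and the solution above gives equality throughout.
-/

namespace NagyGN

open Filter Topology

section WeakDerivative

variable {f u v g φ χ Φ : ℝ → ℝ} {a b : ℝ}

lemma intervalIntegrable_of_locallyIntegrable (hg : LocallyIntegrable g volume) (a b : ℝ) :
    IntervalIntegrable g volume a b :=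
  intervalIntegrable_iff.2
    ((hg.integrableOn_isCompact isCompact_uIcc).mono_set uIoc_subset_uIcc)

lemma continuous_primitive_of_locallyIntegrable (hg : LocallyIntegrable g volume) (a : ℝ) :
    Continuous fun x => ∫ t in a..x, g t :=
  intervalIntegral.continuous_primitive (intervalIntegrable_of_locallyIntegrable hg) a

lemma hasDerivAt_primitive_of_continuous (hΦ : Continuous Φ) (a x : ℝ) :
    HasDerivAt (fun x => ∫ t in a..x, Φ t) (Φ x) x :=
  intervalIntegral.integral_hasDerivAt_right (hΦ.intervalIntegrable _ _)
    (hΦ.stronglyMeasurableAtFilter _ _) hΦ.continuousAt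

lemma deriv_primitive_of_continuous (hΦ : Continuous Φ) (a : ℝ) :
    deriv (fun x => ∫ t in a..x, Φ t) = Φ :=
  funext fun x => (hasDerivAt_primitive_of_continuous hΦ a x).deriv

lemma exists_tsupport_subset_Ioo (hφ : HasCompactSupport φ) :
    ∃ K : ℝ, 0 < K ∧ tsupport φ ⊆ Ioo (-K) K := by
  obtain ⟨K, hK, hsub⟩ := hφ.isCompact.isBounded.subset_ball_lt 0 0
  exact ⟨K, hK, by simpa [Real.ball_eq_Ioo] using hsub⟩

lemma exists_contDiff_hasCompactSupport_deriv_eq (hχ : ContDiff ℝ ∞ χ) (hc : HasCompactSupport χ)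
    (h0 : ∫ x, χ x = 0) :
    ∃ φ : ℝ → ℝ, ContDiff ℝ ∞ φ ∧ HasCompactSupport φ ∧ deriv φ = χ := by
  obtain ⟨K, -, hsub⟩ := exists_tsupport_subset_Ioo hc
  have hsupp : Function.support χ ⊆ Ioo (-K) K := (subset_tsupport χ).trans hsub
  have hder := deriv_primitive_of_continuous hχ.continuous (-K)
  refine ⟨_, ?_, ?_, hder⟩
  · rw [contDiff_infty_iff_deriv]
    exact ⟨fun x => (hasDerivAt_primitive_of_continuous hχ.continuous _ x).differentiableAt,
      by rwa [hder]⟩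
  · refine HasCompactSupport.intro (isCompact_Icc (a := -K) (b := K)) fun x hx => ?_
    rcases lt_or_ge x (-K) with h | h
    · refine intervalIntegral.integral_zero_ae (ae_of_all _ fun t ht => ?_)
      rw [uIoc_of_ge h.le] at ht
      exact Function.notMem_support.1 fun h' => (hsupp h').1.not_ge ht.2
    · have hKx : K < x := not_le.1 fun h' => hx ⟨h, h'⟩
      rw [intervalIntegral.integral_eq_integral_of_support_subset
        fun t ht => ⟨(hsupp ht).1, ((hsupp ht).2.trans hKx).le⟩, h0]

lemma integrable_mul_of_hasCompactSupport (hf : LocallyIntegrable f volume)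
    (hφ : Continuous φ) (hc : HasCompactSupport φ) : Integrable fun x => f x * φ x := by
  simpa only [smul_eq_mul, mul_comm] using hf.integrable_smul_left_of_hasCompactSupport hφ hc

/-- The lemma of du Bois-Reymond. -/
lemma ae_eq_const_of_integral_mul_deriv_eq_zero (hf : LocallyIntegrable f volume)
    (h : ∀ φ : ℝ → ℝ, ContDiff ℝ ∞ φ → HasCompactSupport φ → ∫ x, f x * deriv φ x = 0) :
    ∃ c : ℝ, ∀ᵐ x, f x = c := by
  let b : ContDiffBump (0 : ℝ) := ⟨1, 2, by norm_num, by norm_num⟩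
  set β : ℝ → ℝ := b.normed volume
  have hb : ContDiff ℝ ∞ β := b.contDiff_normed
  have hbc : HasCompactSupport β := b.hasCompactSupport_normed
  have hfβ := integrable_mul_of_hasCompactSupport hf hb.continuous hbc
  refine ⟨∫ x, f x * β x,
    ae_eq_of_integral_contDiff_smul_eq hf (locallyIntegrable_const _) fun ψ hψ hψc => ?_⟩
  have hfψ := integrable_mul_of_hasCompactSupport hf hψ.continuous hψc
  -- Subtracting a multiple of `β` from `ψ` makes the integral vanish, so a derivative remains.
  obtain ⟨φ, hφ, hφc, hφd⟩ := exists_contDiff_hasCompactSupport_deriv_eq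
    (χ := fun x => ψ x - (∫ y, ψ y) * β x) (hψ.sub (contDiff_const.mul hb))
    (hψc.sub (hbc.mul_left (f := fun _ => ∫ y, ψ y))) <| by
      rw [integral_sub (hψ.continuous.integrable_of_hasCompactSupport hψc)
        ((hb.continuous.integrable_of_hasCompactSupport hbc).const_mul _), integral_const_mul,
        b.integral_normed, mul_one, sub_self]
  have key := h φ hφ hφc
  simp_rw [hφd, mul_sub, mul_left_comm (f _)] at key
  rw [integral_sub hfψ (hfβ.const_mul _), integral_const_mul, sub_eq_zero] at key
  simp_rw [smul_eq_mul, integral_mul_const, ← key, mul_comm]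

lemma integral_primitive_mul_deriv (hg : LocallyIntegrable g volume) (hφ : ContDiff ℝ ∞ φ)
    (hc : HasCompactSupport φ) :
    ∫ x, (∫ t in (0 : ℝ)..x, g t) * deriv φ x = -∫ x, g x * φ x := by
  obtain ⟨K, hK, hsub⟩ := exists_tsupport_subset_Ioo hc
  have hzero : ∀ x ∉ Ioo (-K) K, φ x = 0 := fun x hx =>
    image_eq_zero_of_notMem_tsupport fun h => hx (hsub h)
  have integral_eq : ∀ {F : ℝ → ℝ}, Function.support F ⊆ Ioo (-K) K →
      ∫ x in (-K)..K, F x = ∫ x, F x := fun hF =>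
    intervalIntegral.integral_eq_integral_of_support_subset (hF.trans Ioo_subset_Ioc_self)
  have hparts := ((intervalIntegrable_of_locallyIntegrable hg (-K) K)
    |>.absolutelyContinuousOnInterval_intervalIntegral
      (mem_uIcc_of_le (neg_nonpos.2 hK.le) hK.le)).integral_mul_deriv_eq_deriv_mul
    (hφ.contDiffOn.of_le (by simp)).absolutelyContinuousOnInterval
  have hderiv : ∫ x in (-K)..K, deriv (fun x => ∫ t in (0 : ℝ)..x, g t) x * φ x =
      ∫ x in (-K)..K, g x * φ x := by
    refine intervalIntegral.integral_congr_ae ?_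
    filter_upwards [_root_.LocallyIntegrable.ae_hasDerivAt_integral hg] with x hx _
    rw [(hx 0).deriv]
  rw [hzero K (by simp), hzero (-K) (by simp), mul_zero, mul_zero, sub_zero, zero_sub, hderiv,
    integral_eq fun x hx => ?_, integral_eq fun x hx => ?_] at hparts
  · exact hparts
  · exact not_imp_comm.1 (hzero x) (right_ne_zero_of_mul hx)
  · exact hsub (support_deriv_subset (right_ne_zero_of_mul hx))

lemma hasWeakDeriv_of_hasDerivAt (h : ∀ x, HasDerivAt u (g x) x) (hg : Continuous g) :
    HasWeakDeriv u g := by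
  have hu : Continuous u := continuous_iff_continuousAt.2 fun x => (h x).continuousAt
  refine ⟨hu.locallyIntegrable, hg.locallyIntegrable, fun φ hφ hc => ?_⟩
  exact integral_mul_deriv_eq_deriv_mul_of_integrable (fun x _ => h x)
    (fun x _ => (hφ.differentiable (by simp) x).hasDerivAt)
    ((hu.mul (hφ.continuous_deriv (by simp))).integrable_of_hasCompactSupport hc.deriv.mul_left)
    ((hg.mul hφ.continuous).integrable_of_hasCompactSupport hc.mul_left)
    ((hu.mul hφ.continuous).integrable_of_hasCompactSupport hc.mul_left)

namespace HasWeakDeriv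

lemma congr_ae (h : HasWeakDeriv u g) (huv : u =ᵐ[volume] v) : HasWeakDeriv v g := by
  refine ⟨h.1.congr huv, h.2.1, fun φ hφ hc => ?_⟩
  rw [← h.2.2 φ hφ hc]
  exact integral_congr_ae (huv.mono fun x hx => by simp only [hx])

lemma exists_ae_eq_primitive (h : HasWeakDeriv u g) :
    ∃ c : ℝ, u =ᵐ[volume] fun x => c + ∫ t in (0 : ℝ)..x, g t := by
  obtain ⟨hu, hg, hw⟩ := h
  have hv := (continuous_primitive_of_locallyIntegrable hg 0).locallyIntegrable (μ := volume)
  obtain ⟨c, hc⟩ := ae_eq_const_of_integral_mul_deriv_eq_zero (hu.sub hv) fun φ hφ hφc => by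
    have hφ' : Continuous (deriv φ) := hφ.continuous_deriv (by simp)
    simp_rw [Pi.sub_apply, sub_mul]
    rw [integral_sub (integrable_mul_of_hasCompactSupport hu hφ' hφc.deriv)
      (integrable_mul_of_hasCompactSupport hv hφ' hφc.deriv), hw φ hφ hφc,
      integral_primitive_mul_deriv hg hφ hφc, sub_self]
  exact ⟨c, hc.mono fun x hx => sub_eq_iff_eq_add.1 hx⟩

lemma exists_continuous_ae_eq (h : HasWeakDeriv u g) :
    ∃ v : ℝ → ℝ, Continuous v ∧ u =ᵐ[volume] v := by
  obtain ⟨c, hc⟩ := h.exists_ae_eq_primitive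
  exact ⟨_, continuous_const.add (continuous_primitive_of_locallyIntegrable h.2.1 0), hc⟩

lemma eq_add_integral (h : HasWeakDeriv v g) (hv : Continuous v) (a x : ℝ) :
    v x = v a + ∫ t in a..x, g t := by
  obtain ⟨c, hc⟩ := h.exists_ae_eq_primitive
  have heq := hv.ae_eq_iff_eq volume
    (continuous_const.add (continuous_primitive_of_locallyIntegrable h.2.1 0)) |>.1 hc
  have hint := intervalIntegrable_of_locallyIntegrable h.2.1
  rw [heq, ← intervalIntegral.integral_interval_sub_left (hint 0 x) (hint 0 a)]
  simp only [Pi.add_apply]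
  ring

lemma ae_hasDerivAt (h : HasWeakDeriv v g) (hv : Continuous v) : ∀ᵐ x, HasDerivAt v (g x) x := by
  filter_upwards [_root_.LocallyIntegrable.ae_hasDerivAt_integral h.2.1] with x hx
  rw [funext (h.eq_add_integral hv 0)]
  exact (hx 0).const_add _

lemma absolutelyContinuousOnInterval (h : HasWeakDeriv v g) (hv : Continuous v) (a b : ℝ) :
    AbsolutelyContinuousOnInterval v a b := by
  rw [funext (h.eq_add_integral hv a)]
  exact (contDiff_const (n := 1)).contDiffOn.absolutelyContinuousOnInterval.add
    ((intervalIntegrable_of_locallyIntegrable h.2.1 a b)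
      |>.absolutelyContinuousOnInterval_intervalIntegral left_mem_uIcc)

end HasWeakDeriv

end WeakDerivative

section Variation

variable {f v g F Φ : ℝ → ℝ} {a b : ℝ}

lemma absolutelyContinuousOnInterval_comp {K : NNReal} {s : Set ℝ} (hF : LipschitzOnWith K F s)
    (hv : AbsolutelyContinuousOnInterval v a b) (hvs : MapsTo v (uIcc a b) s) :
    AbsolutelyContinuousOnInterval (fun x => F (v x)) a b := by
  rw [absolutelyContinuousOnInterval_iff] at hv ⊢
  intro ε hε
  obtain ⟨δ, hδ, h⟩ := hv (ε / (K + 1)) (by positivity)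
  refine ⟨δ, hδ, fun E hE hlt => ?_⟩
  calc ∑ i ∈ Finset.range E.1, dist (F (v (E.2 i).1)) (F (v (E.2 i).2))
      ≤ ∑ i ∈ Finset.range E.1, (K + 1) * dist (v (E.2 i).1) (v (E.2 i).2) := by
        refine Finset.sum_le_sum fun i hi => ?_
        have hi := hE.1 i hi
        refine (hF.dist_le_mul _ (hvs hi.1) _ (hvs hi.2)).trans ?_
        gcongr
        exact le_add_of_nonneg_right zero_le_one
    _ = (∑ i ∈ Finset.range E.1, dist (v (E.2 i).1) (v (E.2 i).2)) * (K + 1) := by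
        rw [← Finset.mul_sum, mul_comm]
    _ < ε := (lt_div_iff₀ (by positivity)).1 (h E hE hlt)

lemma absolutelyContinuousOnInterval_comp_of_contDiff (hF : ContDiff ℝ 1 F)
    (hv : AbsolutelyContinuousOnInterval v a b) :
    AbsolutelyContinuousOnInterval (fun x => F (v x)) a b := by
  obtain ⟨L, hL⟩ := hv.exists_bound
  obtain ⟨K, hK⟩ := hF.contDiffOn.exists_lipschitzOnWith (n := 1) (s := Icc (-L) L) (by simp)
    (convex_Icc _ _) isCompact_Icc
  exact absolutelyContinuousOnInterval_comp hK hv fun x hx => abs_le.1 (hL x hx)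

lemma contDiff_primitive_of_continuous (hΦ : Continuous Φ) (a : ℝ) :
    ContDiff ℝ 1 fun x => ∫ t in a..x, Φ t := by
  rw [contDiff_one_iff_deriv, deriv_primitive_of_continuous hΦ]
  exact ⟨fun x => (hasDerivAt_primitive_of_continuous hΦ a x).differentiableAt, hΦ⟩

lemma monotone_primitive_of_nonneg (hΦ : Continuous Φ) (h0 : ∀ t, 0 ≤ Φ t) (a : ℝ) :
    Monotone fun x => ∫ t in a..x, Φ t :=
  monotone_of_deriv_nonneg ((contDiff_primitive_of_continuous hΦ a).differentiable one_ne_zero)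
    fun x => by rw [deriv_primitive_of_continuous hΦ]; exact h0 x

lemma abs_primitive_eq_primitive_abs (hΦ : Continuous Φ) (h0 : ∀ t, 0 ≤ Φ t)
    (heven : ∀ t, Φ (-t) = Φ t) (x : ℝ) :
    |∫ t in (0 : ℝ)..x, Φ t| = ∫ t in (0 : ℝ)..|x|, Φ t := by
  have nonneg : ∀ {y}, 0 ≤ y → 0 ≤ ∫ t in (0 : ℝ)..y, Φ t := fun hy => by
    simpa using monotone_primitive_of_nonneg hΦ h0 0 hy
  rcases le_total 0 x with h | h
  · rw [abs_of_nonneg h, abs_of_nonneg (nonneg h)]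
  · have hodd : ∫ t in (0 : ℝ)..-x, Φ t = -∫ t in (0 : ℝ)..x, Φ t := by
      rw [← intervalIntegral.integral_symm]
      simpa [heven] using intervalIntegral.integral_comp_neg (a := 0) (b := -x) Φ
    have := nonneg (neg_nonneg.2 h)
    rw [abs_of_nonpos h, abs_of_nonpos (by linarith), hodd]

lemma exists_mem_lt_of_integrable {α : Type*} [MeasurableSpace α] {μ : Measure α} {f : α → ℝ}
    (hf : Integrable f μ) {s : Set α} (hs : μ s = ⊤) {ε : ℝ} (hε : 0 < ε) :
    ∃ x ∈ s, f x < ε := by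
  by_contra! h
  exact (hf.measure_norm_ge_lt_top hε).not_ge
    (hs ▸ measure_mono fun x hx => (h x hx).trans (le_abs_self _))

lemma frequently_lt_atBot_of_integrable (hf : Integrable f) {ε : ℝ} (hε : 0 < ε) :
    ∃ᶠ x in atBot, f x < ε :=
  frequently_atBot.2 fun _ => exists_mem_lt_of_integrable hf Real.volume_Iic hε

lemma frequently_lt_atTop_of_integrable (hf : Integrable f) {ε : ℝ} (hε : 0 < ε) :
    ∃ᶠ x in atTop, f x < ε :=
  frequently_atTop.2 fun _ => exists_mem_lt_of_integrable hf Real.volume_Ici hε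

namespace HasWeakDeriv

lemma abs_primitive_comp_sub_le (h : HasWeakDeriv v g) (hv : Continuous v) (hΦ : Continuous Φ)
    (h0 : ∀ t, 0 ≤ Φ t) (hab : a ≤ b) :
    |(∫ t in (0 : ℝ)..v b, Φ t) - ∫ t in (0 : ℝ)..v a, Φ t| ≤ ∫ x in a..b, |g x| * Φ (v x) := by
  have hac := absolutelyContinuousOnInterval_comp_of_contDiff
    (contDiff_primitive_of_continuous hΦ 0) (h.absolutelyContinuousOnInterval hv a b)
  rw [← hac.integral_deriv_eq_sub]
  refine (intervalIntegral.abs_integral_le_integral_abs hab).trans_eq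
    (intervalIntegral.integral_congr_ae ?_)
  filter_upwards [h.ae_hasDerivAt hv] with x hx _
  have hchain : HasDerivAt (fun x => ∫ t in (0 : ℝ)..v x, Φ t) (Φ (v x) * g x) x :=
    (hasDerivAt_primitive_of_continuous hΦ 0 (v x)).comp x hx
  rw [hchain.deriv, abs_mul, abs_of_nonneg (h0 _), mul_comm]

/-- `v` climbs from near zero to `|v x₀|` and back down, so that the integral of `|v'| Φ(v)`
counts the primitive of `Φ` up to `|v x₀|` twice. -/
lemma two_mul_primitive_abs_le_integral (h : HasWeakDeriv v g) (hv : Continuous v)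
    (hbot : ∀ ε > 0, ∃ᶠ x in atBot, |v x| < ε) (htop : ∀ ε > 0, ∃ᶠ x in atTop, |v x| < ε)
    (hΦ : Continuous Φ) (h0 : ∀ t, 0 ≤ Φ t) (heven : ∀ t, Φ (-t) = Φ t)
    (hint : Integrable fun x => |g x| * Φ (v x)) (x₀ : ℝ) :
    2 * ∫ t in (0 : ℝ)..|v x₀|, Φ t ≤ ∫ x, |g x| * Φ (v x) := by
  set F : ℝ → ℝ := fun x => ∫ t in (0 : ℝ)..x, Φ t
  have hmono : Monotone F := monotone_primitive_of_nonneg hΦ h0 0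
  have habs : ∀ x, |F x| = F |x| := abs_primitive_eq_primitive_abs hΦ h0 heven
  have key : ∀ ε > 0, 2 * F |v x₀| ≤ (∫ x, |g x| * Φ (v x)) + 2 * F ε := fun ε hε => by
    obtain ⟨a, ha, hva⟩ := frequently_atBot.1 (hbot ε hε) x₀
    obtain ⟨b, hb, hvb⟩ := frequently_atTop.1 (htop ε hε) x₀
    have hleft : F |v x₀| - F |v a| ≤ ∫ x in a..x₀, |g x| * Φ (v x) := by
      rw [← habs, ← habs]
      exact (abs_sub_abs_le_abs_sub _ _).trans (h.abs_primitive_comp_sub_le hv hΦ h0 ha)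
    have hright : F |v x₀| - F |v b| ≤ ∫ x in x₀..b, |g x| * Φ (v x) := by
      rw [← habs, ← habs]
      exact (abs_sub_abs_le_abs_sub _ _).trans
        (abs_sub_comm (F (v b)) _ ▸ h.abs_primitive_comp_sub_le hv hΦ h0 hb)
    have hsum : (∫ x in a..x₀, |g x| * Φ (v x)) + (∫ x in x₀..b, |g x| * Φ (v x)) ≤
        ∫ x, |g x| * Φ (v x) := by
      rw [intervalIntegral.integral_add_adjacent_intervals hint.intervalIntegrable
        hint.intervalIntegrable, intervalIntegral.integral_of_le (ha.trans hb)]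
      exact setIntegral_le_integral hint
        (ae_of_all _ fun x => mul_nonneg (abs_nonneg _) (h0 _))
    linarith [hmono hva.le, hmono hvb.le]
  have hlim : Tendsto (fun ε => (∫ x, |g x| * Φ (v x)) + 2 * F ε) (𝓝[>] 0)
      (𝓝 (∫ x, |g x| * Φ (v x))) := by
    have hFc : Continuous F := (contDiff_primitive_of_continuous hΦ 0).continuous
    have hc : Continuous fun ε => (∫ x, |g x| * Φ (v x)) + 2 * F ε := by fun_prop
    have hF0 : F 0 = 0 := intervalIntegral.integral_same
    simpa only [hF0, mul_zero, add_zero] using (hc.tendsto 0).mono_left nhdsWithin_le_nhds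
  exact ge_of_tendsto hlim (eventually_mem_nhdsWithin.mono key)

end HasWeakDeriv

end Variation

section Integrability

variable {α : Type*} [MeasurableSpace α] {μ : Measure α} {f : α → ℝ} {r : ℝ}

lemma memLp_ofReal_iff_integrable_abs_rpow (hf : AEStronglyMeasurable f μ) (hr : 0 < r) :
    MemLp f (ENNReal.ofReal r) μ ↔ Integrable (fun x => |f x| ^ r) μ := by
  rw [← integrable_norm_rpow_iff hf (by simpa using hr) (by simp), ENNReal.toReal_ofReal hr.le]
  rfl

lemma eLpNorm_ofReal_eq_ofReal_integral (hr : 0 < r) (hf : MemLp f (ENNReal.ofReal r) μ) :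
    eLpNorm f (ENNReal.ofReal r) μ = ENNReal.ofReal ((∫ x, |f x| ^ r ∂μ) ^ (1 / r)) := by
  rw [hf.eLpNorm_eq_integral_rpow_norm (by simpa using hr) (by simp),
    ENNReal.toReal_ofReal hr.le, one_div]
  simp only [Real.norm_eq_abs]

lemma integral_abs_rpow_nonneg (f : α → ℝ) (r : ℝ) : 0 ≤ ∫ x, |f x| ^ r ∂μ :=
  integral_nonneg fun _ => Real.rpow_nonneg (abs_nonneg _) _

lemma integral_abs_mul_rpow (f : α → ℝ) {l : ℝ} (hl : 0 ≤ l) (r : ℝ) :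
    ∫ x, |l * f x| ^ r ∂μ = l ^ r * ∫ x, |f x| ^ r ∂μ := by
  simp_rw [abs_mul, abs_of_nonneg hl, Real.mul_rpow hl (abs_nonneg _), integral_const_mul]

lemma integrable_abs_rpow_of_bddAbove {s : ℝ} (hr : 0 ≤ r) (hrs : r ≤ s)
    (hf : AEStronglyMeasurable f μ) (hbdd : BddAbove (range fun x => |f x|))
    (hfr : Integrable (fun x => |f x| ^ r) μ) : Integrable (fun x => |f x| ^ s) μ := by
  obtain ⟨B, hB⟩ := hbdd
  refine (hfr.mul_const (B ^ (s - r))).mono'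
    (hf.norm.aemeasurable.pow_const s).aestronglyMeasurable (ae_of_all _ fun x => ?_)
  have hsplit : |f x| ^ s = |f x| ^ r * |f x| ^ (s - r) := by
    rw [← Real.rpow_add_of_nonneg (abs_nonneg _) hr (sub_nonneg.2 hrs), add_sub_cancel]
  rw [Real.norm_of_nonneg (Real.rpow_nonneg (abs_nonneg _) _), hsplit]
  have : |f x| ^ (s - r) ≤ B ^ (s - r) :=
    Real.rpow_le_rpow (abs_nonneg _) (hB ⟨x, rfl⟩) (sub_nonneg.2 hrs)
  gcongr

lemma holderConjugate_div_sub_one {p : ℝ} (hp : 1 < p) : p.HolderConjugate (p / (p - 1)) :=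
  Real.HolderConjugate.conjExponent hp

lemma integrable_abs_mul_of_memLp {g : α → ℝ} {p : ℝ} (hp : 1 < p)
    (hg : MemLp g (ENNReal.ofReal p) μ) (hf : MemLp f (ENNReal.ofReal (p / (p - 1))) μ) :
    Integrable (fun x => |g x| * f x) μ :=
  have := (holderConjugate_div_sub_one hp).ennrealOfReal
  hg.abs.integrable_mul hf

end Integrability

section Calibration

/-- The potential of the free boundary problem: its equation reads
`(|u'|^{p-2} u')' = potential'(u)`. -/
noncomputable def potential (q m t : ℝ) : ℝ := t ^ (q + 1) / (q + 1) - t ^ (m + 1) / (m + 1)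

/-- The positive zero of the potential, which is the height of the compactly supported solution. -/
noncomputable def peak (q m : ℝ) : ℝ := ((m + 1) / (q + 1)) ^ (1 / (m - q))

/-- The value of `|u'|^{p-1}` at height `t` on a solution of the free boundary problem, as dictated
by conservation of energy; it is extended to an even function that vanishes above the peak. -/
noncomputable def momentum (p q m t : ℝ) : ℝ :=
  (p / (p - 1) * max (potential q m |t|) 0) ^ ((p - 1) / p)

/-- The integral of `momentum(u) |u'| = |u'|^p` over the line for the compactly supported solution,
which passes through each height below the peak twice. -/
noncomputable def action (p q m : ℝ) : ℝ := 2 * ∫ t in (0 : ℝ)..peak q m, momentum p q m t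

variable {p q m t : ℝ} {v g : ℝ → ℝ}

lemma peak_pos (hq : -1 < q) (hqm : q < m) : 0 < peak q m :=
  Real.rpow_pos_of_pos (div_pos (by linarith) (by linarith)) _

lemma peak_rpow (hq : -1 < q) (hqm : q < m) : peak q m ^ (m - q) = (m + 1) / (q + 1) := by
  rw [peak, one_div, Real.rpow_inv_rpow (div_nonneg (by linarith) (by linarith)) (by linarith)]

lemma potential_eq (hq : -1 < q) (hqm : q < m) (ht : 0 ≤ t) :
    potential q m t = t ^ (q + 1) / (q + 1) * (1 - (t / peak q m) ^ (m - q)) := by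
  have hq1 : q + 1 ≠ 0 := by linarith
  have hm1 : m + 1 ≠ 0 := by linarith
  have hsplit : t ^ (m + 1) = t ^ (q + 1) * t ^ (m - q) := by
    rw [← Real.rpow_add_of_nonneg ht (by linarith) (by linarith)]; congr 1; ring
  rw [potential, Real.div_rpow ht (peak_pos hq hqm).le, peak_rpow hq hqm, hsplit]
  field_simp

lemma potential_pos (hq : -1 < q) (hqm : q < m) (ht : 0 < t) (htM : t < peak q m) :
    0 < potential q m t := by
  have hlt : (t / peak q m) ^ (m - q) < 1 :=
    Real.rpow_lt_one (div_nonneg ht.le (peak_pos hq hqm).le)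
      ((div_lt_one (peak_pos hq hqm)).2 htM) (by linarith)
  rw [potential_eq hq hqm ht.le]
  exact mul_pos (div_pos (Real.rpow_pos_of_pos ht _) (by linarith)) (sub_pos.2 hlt)

lemma potential_zero (hq : -1 < q) (hqm : q < m) : potential q m 0 = 0 := by
  rw [potential, Real.zero_rpow (by linarith), Real.zero_rpow (by linarith), zero_div, zero_div,
    sub_zero]

lemma potential_peak (hq : -1 < q) (hqm : q < m) : potential q m (peak q m) = 0 := by
  rw [potential_eq hq hqm (peak_pos hq hqm).le, div_self (peak_pos hq hqm).ne', Real.one_rpow,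
    sub_self, mul_zero]

lemma potential_nonneg (hq : -1 < q) (hqm : q < m) (ht : 0 ≤ t) (htM : t ≤ peak q m) :
    0 ≤ potential q m t := by
  rcases ht.eq_or_lt with rfl | ht
  · exact (potential_zero hq hqm).ge
  rcases htM.eq_or_lt with rfl | htM
  · exact (potential_peak hq hqm).ge
  · exact (potential_pos hq hqm ht htM).le

lemma continuous_potential (hq : -1 < q) (hqm : q < m) : Continuous (potential q m) :=
  ((Real.continuous_rpow_const (by linarith)).div_const _).sub
    ((Real.continuous_rpow_const (by linarith)).div_const _)

lemma continuous_momentum (hp : 1 < p) (hq : -1 < q) (hqm : q < m) :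
    Continuous (momentum p q m) :=
  (continuous_const.mul (((continuous_potential hq hqm).comp continuous_abs).max
    continuous_const)).rpow_const fun _ => Or.inr (div_nonneg (by linarith) (by linarith))

lemma momentum_nonneg (hp : 1 < p) (t : ℝ) : 0 ≤ momentum p q m t :=
  Real.rpow_nonneg (mul_nonneg (div_nonneg (by linarith) (by linarith)) (le_max_right _ _)) _

lemma momentum_eq (hq : -1 < q) (hqm : q < m) (ht : 0 ≤ t) (htM : t ≤ peak q m) :
    momentum p q m t = (p / (p - 1) * potential q m t) ^ ((p - 1) / p) := by
  rw [momentum, abs_of_nonneg ht, max_eq_left (potential_nonneg hq hqm ht htM)]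

lemma momentum_rpow (hp : 1 < p) (hq : -1 < q) (hqm : q < m) (ht : |t| ≤ peak q m) :
    momentum p q m t ^ (p / (p - 1)) = p / (p - 1) * potential q m |t| := by
  have hpot := potential_nonneg hq hqm (abs_nonneg t) ht
  rw [momentum, max_eq_left hpot, ← inv_div p, Real.rpow_inv_rpow
    (mul_nonneg (div_nonneg (by linarith) (by linarith)) hpot)
    (div_pos (by linarith) (by linarith)).ne']

lemma action_pos (hp : 1 < p) (hq : -1 < q) (hqm : q < m) : 0 < action p q m := by
  refine mul_pos two_pos (intervalIntegral.intervalIntegral_pos_of_pos_on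
    ((continuous_momentum hp hq hqm).intervalIntegrable _ _) (fun t ht => ?_) (peak_pos hq hqm))
  rw [momentum_eq hq hqm ht.1.le ht.2.le]
  exact Real.rpow_pos_of_pos
    (mul_pos (div_pos (by linarith) (by linarith)) (potential_pos hq hqm ht.1 ht.2)) _

namespace MemX

lemma const_mul (h : MemX p q v g) (l : ℝ) :
    MemX p q (fun x => l * v x) fun x => l * g x := by
  obtain ⟨hv, ⟨hvl, hgl, hw⟩, hg⟩ := h
  refine ⟨hv.const_mul l, ⟨hvl.smul l, hgl.smul l, fun φ hφ hc => ?_⟩, hg.const_mul l⟩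
  simp_rw [mul_assoc, integral_const_mul, hw φ hφ hc, mul_neg]

lemma integrable_abs_rpow (hq : -1 < q) (h : MemX p q v g) :
    Integrable fun x => |v x| ^ (q + 1) :=
  (memLp_ofReal_iff_integrable_abs_rpow h.1.1 (by linarith)).1 h.1

lemma two_mul_primitive_abs_le_integral (hp : 1 < p) (hq : -1 < q) (h : MemX p q v g)
    (hv : Continuous v) {Φ : ℝ → ℝ} (hΦ : Continuous Φ) (h0 : ∀ t, 0 ≤ Φ t)
    (heven : ∀ t, Φ (-t) = Φ t) (hΦv : MemLp (fun x => Φ (v x)) (ENNReal.ofReal (p / (p - 1))))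
    (x₀ : ℝ) : 2 * ∫ t in (0 : ℝ)..|v x₀|, Φ t ≤ ∫ x, |g x| * Φ (v x) := by
  have hq1 : 0 < q + 1 := by linarith
  have hint := h.integrable_abs_rpow hq
  have lt_of_rpow_lt : ∀ ε > 0, ∀ x, |v x| ^ (q + 1) < ε ^ (q + 1) → |v x| < ε :=
    fun ε hε x => (Real.rpow_lt_rpow_iff (abs_nonneg _) hε.le hq1).1
  exact h.2.1.two_mul_primitive_abs_le_integral hv
    (fun ε hε => (frequently_lt_atBot_of_integrable hint (Real.rpow_pos_of_pos hε _)).mono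
      (lt_of_rpow_lt ε hε))
    (fun ε hε => (frequently_lt_atTop_of_integrable hint (Real.rpow_pos_of_pos hε _)).mono
      (lt_of_rpow_lt ε hε))
    hΦ h0 heven (integrable_abs_mul_of_memLp hp h.2.2 hΦv) x₀

/-- The variation inequality with the density `Φ t = |t| ^ k`, whose exponent is chosen such that
`Φ(v)` lies in the dual of `L^p` as soon as `v` lies in `L^{q+1}`. -/
lemma bddAbove_range_abs (hp : 1 < p) (hq : -1 < q) (h : MemX p q v g) (hv : Continuous v) :
    BddAbove (range fun x => |v x|) := by
  have hp1 : p - 1 ≠ 0 := by linarith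
  have hp0 : p ≠ 0 := by linarith
  set k := (q + 1) * ((p - 1) / p) with hk
  have hkpos : 0 < k := mul_pos (by linarith) (div_pos (by linarith) (by linarith))
  have hΦ : Continuous fun t : ℝ => |t| ^ k :=
    continuous_abs.rpow_const fun _ => Or.inr hkpos.le
  have hmem : MemLp (fun x => |v x| ^ k) (ENNReal.ofReal (p / (p - 1))) := by
    refine (memLp_ofReal_iff_integrable_abs_rpow (hΦ.comp hv).aestronglyMeasurable
      (div_pos (by linarith) (by linarith))).2 ?_
    refine (h.integrable_abs_rpow hq).congr (ae_of_all _ fun x => ?_)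
    simp only [Function.comp_apply, abs_of_nonneg (Real.rpow_nonneg (abs_nonneg (v x)) k)]
    rw [← Real.rpow_mul (abs_nonneg _), hk]
    congr 1
    field_simp
  have hprim : ∀ y : ℝ, 0 ≤ y → ∫ t in (0 : ℝ)..y, |t| ^ k = y ^ (k + 1) / (k + 1) := fun y hy => by
    rw [intervalIntegral.integral_congr (g := fun t => t ^ k) fun t ht => by
        simp only [abs_of_nonneg (uIcc_of_le hy ▸ ht).1],
      integral_rpow (Or.inl (by linarith)), Real.zero_rpow (by linarith), sub_zero]
  set I := ∫ x, |g x| * |v x| ^ k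
  refine ⟨((k + 1) * I / 2) ^ (k + 1)⁻¹, forall_mem_range.2 fun x => ?_⟩
  have hvar : 2 * (|v x| ^ (k + 1) / (k + 1)) ≤ I := by
    rw [← hprim _ (abs_nonneg _)]
    exact h.two_mul_primitive_abs_le_integral hp hq hv hΦ
      (fun t => Real.rpow_nonneg (abs_nonneg _) _) (fun t => by rw [abs_neg]) hmem x
  rw [Real.le_rpow_inv_iff_of_pos (abs_nonneg _) ?_ (by linarith)]
  · field_simp at hvar ⊢
    linarith
  · have : 0 ≤ I := integral_nonneg fun x => by positivity
    positivity

lemma integrable_abs_rpow_of_lt (hp : 1 < p) (hq : -1 < q) (hqm : q < m) (h : MemX p q v g)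
    (hv : Continuous v) : Integrable fun x => |v x| ^ (m + 1) :=
  integrable_abs_rpow_of_bddAbove (by linarith) (by linarith) hv.aestronglyMeasurable
    (h.bddAbove_range_abs hp hq hv) (h.integrable_abs_rpow hq)

/-- The energy `p/(p-1) ∫ potential(v)`, which bounds the action together with `∫ |v'|^p`, is the
integral of a power of the momentum. -/
lemma integrable_momentum_rpow_and_integral_eq (hp : 1 < p) (hq : -1 < q) (hqm : q < m)
    (h : MemX p q v g) (hv : Continuous v) (hle : ∀ x, |v x| ≤ peak q m) :
    Integrable (fun x => momentum p q m (v x) ^ (p / (p - 1))) ∧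
    ∫ x, momentum p q m (v x) ^ (p / (p - 1)) =
      p / (p - 1) * ((∫ x, |v x| ^ (q + 1)) / (q + 1) - (∫ x, |v x| ^ (m + 1)) / (m + 1)) := by
  have hvq := h.integrable_abs_rpow hq
  have hvm := h.integrable_abs_rpow_of_lt hp hq hqm hv
  simp_rw [fun x => momentum_rpow hp hq hqm (hle x), potential]
  refine ⟨((hvq.div_const _).sub (hvm.div_const _)).const_mul _, ?_⟩
  rw [integral_const_mul, integral_sub (hvq.div_const _) (hvm.div_const _), integral_div,
    integral_div]

/-- The calibration inequality: among functions as high as the compactly supported solution, the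
action bounds from below a product of the energies. -/
lemma action_le (hp : 1 < p) (hq : -1 < q) (hqm : q < m) (h : MemX p q v g) (hv : Continuous v)
    (hsup : ⨆ x, |v x| = peak q m) :
    action p q m ≤ (∫ x, |g x| ^ p) ^ (1 / p) *
      (p / (p - 1) * ((∫ x, |v x| ^ (q + 1)) / (q + 1) -
        (∫ x, |v x| ^ (m + 1)) / (m + 1))) ^ ((p - 1) / p) := by
  have hlub : IsLUB (range fun x => |v x|) (peak q m) :=
    hsup ▸ isLUB_ciSup (h.bddAbove_range_abs hp hq hv)
  have hΦ := continuous_momentum hp hq hqm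
  obtain ⟨hint, henergy⟩ := h.integrable_momentum_rpow_and_integral_eq hp hq hqm hv
    fun x => hlub.1 ⟨x, rfl⟩
  have hmem : MemLp (fun x => momentum p q m (v x)) (ENNReal.ofReal (p / (p - 1))) := by
    refine (memLp_ofReal_iff_integrable_abs_rpow (hΦ.comp hv).aestronglyMeasurable
      (div_pos (by linarith) (by linarith))).2 ?_
    simpa only [Function.comp_apply, abs_of_nonneg (momentum_nonneg hp _)] using hint
  have hvar : action p q m ≤ ∫ x, |g x| * momentum p q m (v x) := by
    have hcont : Continuous fun y => 2 * ∫ t in (0 : ℝ)..y, momentum p q m t :=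
      continuous_const.mul (contDiff_primitive_of_continuous hΦ 0).continuous
    refine le_of_tendsto ((hcont.tendsto (peak q m)).mono_left nhdsWithin_le_nhds)
      ((eventually_mem_nhdsWithin (s := Iio (peak q m))).mono fun y hy => ?_)
    obtain ⟨_, ⟨x, rfl⟩, hyx⟩ := (lt_isLUB_iff hlub).1 hy
    refine le_trans ?_ (h.two_mul_primitive_abs_le_integral hp hq hv hΦ (momentum_nonneg hp)
      (fun t => by simp only [momentum, abs_neg]) hmem x)
    have := monotone_primitive_of_nonneg hΦ (momentum_nonneg hp) 0 hyx.le
    gcongr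
  have hHolder := integral_mul_le_Lp_mul_Lq_of_nonneg (holderConjugate_div_sub_one hp)
    (μ := volume) (ae_of_all _ fun x => abs_nonneg (g x))
    (ae_of_all _ fun x => momentum_nonneg hp (v x)) h.2.2.abs hmem
  rw [henergy, one_div_div] at hHolder
  exact hvar.trans hHolder

end MemX

end Calibration

section GagliardoNirenberg

/-- The best constant as a function of the action `A` of the extremal profile `u`, for which
`A * (1 - theta) / theta` is the mass `∫ u ^ (q + 1)`. -/
noncomputable def constOfAction (p q m A : ℝ) : ℝ :=
  theta p q m ^ (-(theta p q m / p)) * (1 - theta p q m) ^ (theta p q m / p - 1 / (m + 1)) *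
    (A * (1 - theta p q m) / theta p q m) ^ (-theta p q m)

/-- The Gagliardo-Nirenberg inequality with constant `C` for a function `v` with derivative `g`,
as an inequality between integrals of real powers. -/
def GNInequality (p q m C : ℝ) (v g : ℝ → ℝ) : Prop :=
  (∫ x, |v x| ^ (m + 1)) ^ (1 / (m + 1)) ≤
    C * (∫ x, |v x| ^ (q + 1)) ^ ((1 - theta p q m) / (q + 1)) *
      (∫ x, |g x| ^ p) ^ (theta p q m / p)

variable {p q m A C : ℝ} {v g : ℝ → ℝ}

lemma eta1_pos (hp : 1 < p) (hm : -1 < m) : 0 < eta1 p m := by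
  have : 0 < (p - 1) * (m + 1) := mul_pos (by linarith) (by linarith)
  unfold eta1
  linarith

lemma eta2_pos (hp : 1 < p) (hq : -1 < q) : 0 < eta2 p q := eta1_pos hp hq

lemma theta_eq : theta p q m = p * (m - q) / ((m + 1) * eta2 p q) := by
  rw [theta, eta2, add_comm p]

lemma one_sub_theta_eq (hp : 1 < p) (hq : -1 < q) (hqm : q < m) :
    1 - theta p q m = (q + 1) * eta1 p m / ((m + 1) * eta2 p q) := by
  have hm1 : m + 1 ≠ 0 := by linarith
  have he2 := (eta2_pos hp hq).ne'
  rw [theta_eq, eq_div_iff (mul_ne_zero hm1 he2), sub_mul,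
    div_mul_cancel₀ _ (mul_ne_zero hm1 he2)]
  unfold eta1 eta2
  ring

lemma theta_pos (hp : 1 < p) (hq : -1 < q) (hqm : q < m) : 0 < theta p q m := by
  rw [theta_eq]
  exact div_pos (mul_pos (by linarith) (by linarith)) (mul_pos (by linarith) (eta2_pos hp hq))

lemma one_sub_theta_pos (hp : 1 < p) (hq : -1 < q) (hqm : q < m) : 0 < 1 - theta p q m := by
  rw [one_sub_theta_eq hp hq hqm]
  exact div_pos (mul_pos (by linarith) (eta1_pos hp (by linarith)))
    (mul_pos (by linarith) (eta2_pos hp hq))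

lemma log_theta (hp : 1 < p) (hq : -1 < q) (hqm : q < m) :
    Real.log (theta p q m) =
      Real.log p + Real.log (m - q) - Real.log (m + 1) - Real.log (eta2 p q) := by
  have hp0 : p ≠ 0 := by linarith
  have hmq : m - q ≠ 0 := by linarith
  have hm1 : m + 1 ≠ 0 := by linarith
  have he2 := (eta2_pos hp hq).ne'
  rw [theta_eq, Real.log_div (mul_ne_zero hp0 hmq) (mul_ne_zero hm1 he2), Real.log_mul hp0 hmq,
    Real.log_mul hm1 he2]
  ring

lemma log_one_sub_theta (hp : 1 < p) (hq : -1 < q) (hqm : q < m) :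
    Real.log (1 - theta p q m) =
      Real.log (q + 1) + Real.log (eta1 p m) - Real.log (m + 1) - Real.log (eta2 p q) := by
  have hq1 : q + 1 ≠ 0 := by linarith
  have he1 := (eta1_pos hp (hq.trans hqm)).ne'
  have hm1 : m + 1 ≠ 0 := by linarith
  have he2 := (eta2_pos hp hq).ne'
  rw [one_sub_theta_eq hp hq hqm, Real.log_div (mul_ne_zero hq1 he1) (mul_ne_zero hm1 he2),
    Real.log_mul hq1 he1, Real.log_mul hm1 he2]
  ring

lemma constOfAction_pos (hp : 1 < p) (hq : -1 < q) (hqm : q < m) (hA : 0 < A) :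
    0 < constOfAction p q m A := by
  have hθ := theta_pos hp hq hqm
  have hθ' := one_sub_theta_pos hp hq hqm
  unfold constOfAction
  positivity

lemma log_constOfAction (hp : 1 < p) (hq : -1 < q) (hqm : q < m) (hA : 0 < A) :
    Real.log (constOfAction p q m A) =
      -(theta p q m / p) * Real.log (theta p q m) +
        (theta p q m / p - 1 / (m + 1)) * Real.log (1 - theta p q m) -
        theta p q m * (Real.log A + Real.log (1 - theta p q m) - Real.log (theta p q m)) := by
  have hθ := theta_pos hp hq hqm
  have hθ' := one_sub_theta_pos hp hq hqm
  have hmass : 0 < A * (1 - theta p q m) / theta p q m := by positivity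
  rw [constOfAction, Real.log_mul (by positivity) (by positivity),
    Real.log_mul (by positivity) (by positivity), Real.log_rpow hθ, Real.log_rpow hθ',
    Real.log_rpow hmass, Real.log_div (by positivity) hθ.ne', Real.log_mul hA.ne' hθ'.ne']
  ring

lemma mul_log_sub_log_add_le_log_add {x y s t : ℝ} (hx : 0 < x) (hy : 0 < y) (hs : 0 < s)
    (ht : 0 < t) (hst : s + t = 1) :
    s * (Real.log x - Real.log s) + t * (Real.log y - Real.log t) ≤ Real.log (x + y) := by
  have := strictConcaveOn_log_Ioi.concaveOn.2 (div_pos hx hs) (div_pos hy ht) hs.le ht.le hst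
  rwa [smul_eq_mul, smul_eq_mul, smul_eq_mul, smul_eq_mul, Real.log_div hx.ne' hs.ne',
    Real.log_div hy.ne' ht.ne', mul_div_cancel₀ _ hs.ne', mul_div_cancel₀ _ ht.ne'] at this

/-- The weights are those with which equality holds for the extremal profile. -/
lemma log_mass_ge {N Q Y : ℝ} (hp : 1 < p) (hq : -1 < q) (hqm : q < m) (hN : 0 < N) (hY : 0 < Y)
    (hQ : Q / (q + 1) = N / (m + 1) + Y) :
    eta2 p q / eta1 p m *
        (Real.log N - Real.log (m + 1) - (Real.log (eta2 p q) - Real.log (eta1 p m))) +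
      (p - 1) * (m - q) / eta1 p m *
        (Real.log Y - (Real.log (p - 1) + Real.log (m - q) - Real.log (eta1 p m))) ≤
      Real.log Q - Real.log (q + 1) := by
  have hp1 : 0 < p - 1 := by linarith
  have hq1 : 0 < q + 1 := by linarith
  have hm1 : 0 < m + 1 := by linarith
  have hmq : 0 < m - q := by linarith
  have he1 := eta1_pos hp (hq.trans hqm)
  have he2 := eta2_pos hp hq
  have hQ0 : 0 < Q := (div_pos_iff_of_pos_right hq1).1 (hQ ▸ by positivity)
  have hweights : eta2 p q / eta1 p m + (p - 1) * (m - q) / eta1 p m = 1 := by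
    rw [← add_div, div_eq_one_iff_eq he1.ne']
    unfold eta1 eta2
    ring
  have := mul_log_sub_log_add_le_log_add (div_pos hN hm1) hY (div_pos he2 he1)
    (div_pos (mul_pos hp1 hmq) he1) hweights
  rwa [← hQ, Real.log_div hQ0.ne' hq1.ne', Real.log_div hN.ne' hm1.ne',
    Real.log_div he2.ne' he1.ne', Real.log_div (mul_pos hp1 hmq).ne' he1.ne',
    Real.log_mul hp1.ne' hmq.ne'] at this

/-- The logarithm of the claimed inequality is a positive combination of the logarithm of the
calibration inequality and of the weighted arithmetic-geometric mean inequality `log_mass_ge`. -/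
lemma rpow_le_of_action_le {N Q D : ℝ} (hp : 1 < p) (hq : -1 < q) (hqm : q < m) (hA : 0 < A)
    (hN : 0 < N) (hD : 0 ≤ D) (hY : 0 ≤ Q / (q + 1) - N / (m + 1))
    (h : A ≤ D ^ (1 / p) * (p / (p - 1) * (Q / (q + 1) - N / (m + 1))) ^ ((p - 1) / p)) :
    N ^ (1 / (m + 1)) ≤ constOfAction p q m A * Q ^ ((1 - theta p q m) / (q + 1)) *
      D ^ (theta p q m / p) := by
  have hp0 : 0 < p := by linarith
  have hp1 : 0 < p - 1 := by linarith
  have hq1 : 0 < q + 1 := by linarith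
  have hm1 : 0 < m + 1 := by linarith
  have hmq : 0 < m - q := by linarith
  have he1 := eta1_pos hp (hq.trans hqm)
  have he2 := eta2_pos hp hq
  have hD' : 0 < D := hD.lt_of_ne' fun h0 => hA.not_ge <| h.trans_eq <| by
    rw [h0, Real.zero_rpow (by positivity), zero_mul]
  obtain ⟨Y, hYdef⟩ : ∃ Y, Y = Q / (q + 1) - N / (m + 1) := ⟨_, rfl⟩
  rw [← hYdef] at hY h
  have hY' : 0 < Y := hY.lt_of_ne' fun h0 => hA.not_ge <| h.trans_eq <| by
    rw [h0, mul_zero, Real.zero_rpow (by positivity), mul_zero]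
  have hQY : Q / (q + 1) = N / (m + 1) + Y := by rw [hYdef]; ring
  have hQ : 0 < Q := (div_pos_iff_of_pos_right hq1).1 (hQY ▸ by positivity)
  have hcal : Real.log A ≤ 1 / p * Real.log D +
      (p - 1) / p * (Real.log p - Real.log (p - 1) + Real.log Y) := by
    have := Real.log_le_log hA h
    rwa [Real.log_mul (by positivity) (by positivity), Real.log_rpow hD',
      Real.log_rpow (by positivity), Real.log_mul (by positivity) hY'.ne',
      Real.log_div hp0.ne' hp1.ne'] at this
  have hC := constOfAction_pos hp hq hqm hA
  rw [← Real.log_le_log_iff (by positivity) (by positivity), Real.log_rpow hN,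
    Real.log_mul (by positivity) (by positivity), Real.log_mul (by positivity) (by positivity),
    Real.log_rpow hQ, Real.log_rpow hD', log_constOfAction hp hq hqm hA, log_theta hp hq hqm,
    log_one_sub_theta hp hq hqm, one_sub_theta_eq hp hq hqm, theta_eq]
  have hmean := mul_nonneg (div_pos he1 (mul_pos hm1 he2)).le
    (sub_nonneg.2 (log_mass_ge hp hq hqm hN hY' hQY))
  have haction := mul_nonneg (div_pos (mul_pos hp0 hmq) (mul_pos hm1 he2)).le (sub_nonneg.2 hcal)
  refine sub_nonneg.1 ((add_nonneg hmean haction).trans_eq ?_)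
  unfold eta1 eta2 at *
  field_simp
  ring

lemma GNInequality.of_const_mul {l : ℝ} (hp : 0 < p) (hq : -1 < q) (hm : -1 < m) (hl : 0 < l)
    (h : GNInequality p q m C (fun x => l * v x) fun x => l * g x) : GNInequality p q m C v g := by
  have hm1 : m + 1 ≠ 0 := by linarith
  have hq1 : q + 1 ≠ 0 := by linarith
  unfold GNInequality at h
  rw [integral_abs_mul_rpow _ hl.le, integral_abs_mul_rpow _ hl.le, integral_abs_mul_rpow _ hl.le,
    Real.mul_rpow (by positivity) (integral_abs_rpow_nonneg _ _),
    Real.mul_rpow (by positivity) (integral_abs_rpow_nonneg _ _),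
    Real.mul_rpow (by positivity) (integral_abs_rpow_nonneg _ _),
    ← Real.rpow_mul hl.le, ← Real.rpow_mul hl.le, ← Real.rpow_mul hl.le,
    mul_one_div_cancel hm1, mul_div_cancel₀ _ hq1, mul_div_cancel₀ _ hp.ne', Real.rpow_one] at h
  have hsplit : l ^ (1 - theta p q m) * l ^ theta p q m = l := by
    rw [← Real.rpow_add hl, sub_add_cancel, Real.rpow_one]
  refine le_of_mul_le_mul_left (h.trans_eq ?_) hl
  conv_rhs => rw [← hsplit]
  ring

namespace MemX

lemma gnInequality_of_iSup_eq_peak (hp : 1 < p) (hq : -1 < q) (hqm : q < m) (h : MemX p q v g)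
    (hv : Continuous v) (hsup : ⨆ x, |v x| = peak q m) (hpos : 0 < ∫ x, |v x| ^ (m + 1)) :
    GNInequality p q m (constOfAction p q m (action p q m)) v g := by
  refine rpow_le_of_action_le hp hq hqm (action_pos hp hq hqm) hpos
    (integral_abs_rpow_nonneg _ _) ?_ (h.action_le hp hq hqm hv hsup)
  have hle : ∀ x, |v x| ≤ peak q m := fun x =>
    hsup ▸ le_ciSup (h.bddAbove_range_abs hp hq hv) x
  have henergy := (h.integrable_momentum_rpow_and_integral_eq hp hq hqm hv hle).2
  exact nonneg_of_mul_nonneg_right (henergy ▸ integral_nonneg fun x =>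
    Real.rpow_nonneg (momentum_nonneg hp _) _) (div_pos (by linarith) (by linarith))

theorem gnInequality (hp : 1 < p) (hq : -1 < q) (hqm : q < m) (h : MemX p q v g)
    (hv : Continuous v) : GNInequality p q m (constOfAction p q m (action p q m)) v g := by
  have hm1 : 0 < m + 1 := by linarith
  have hC := constOfAction_pos hp hq hqm (action_pos hp hq hqm)
  rcases (integral_abs_rpow_nonneg v (m + 1) (μ := volume)).eq_or_lt with hN | hN
  · rw [GNInequality, ← hN, Real.zero_rpow (by positivity)]
    exact mul_nonneg (mul_nonneg hC.le (Real.rpow_nonneg (integral_abs_rpow_nonneg _ _) _))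
      (Real.rpow_nonneg (integral_abs_rpow_nonneg _ _) _)
  have hsup : 0 < ⨆ x, |v x| := by
    refine (Real.iSup_nonneg fun x => abs_nonneg (v x)).lt_of_ne fun h0 => hN.ne' ?_
    have hzero : ∀ x, |v x| = 0 := fun x =>
      ((le_ciSup (h.bddAbove_range_abs hp hq hv) x).trans_eq h0.symm).antisymm (abs_nonneg _)
    simp_rw [hzero, Real.zero_rpow hm1.ne', integral_zero]
  have hl : 0 < peak q m / ⨆ x, |v x| := div_pos (peak_pos hq hqm) hsup
  refine GNInequality.of_const_mul (by linarith) hq (by linarith) hl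
    ((h.const_mul _).gnInequality_of_iSup_eq_peak hp hq hqm (hv.const_mul _) ?_ ?_)
  · simp_rw [abs_mul, abs_of_pos hl]
    rw [← Real.mul_iSup_of_nonneg hl.le, div_mul_cancel₀ _ hsup.ne']
  · rw [integral_abs_mul_rpow _ hl.le]
    exact mul_pos (Real.rpow_pos_of_pos hl _) hN

lemma ofReal_mul_eLpNorm_rpow_eq (hp : 1 < p) (hq : -1 < q) (hqm : q < m) (h : MemX p q v g)
    (hC : 0 ≤ C) :
    ENNReal.ofReal C * eLpNorm v (ENNReal.ofReal (q + 1)) volume ^ (1 - theta p q m) *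
        eLpNorm g (ENNReal.ofReal p) volume ^ theta p q m =
      ENNReal.ofReal (C * (∫ x, |v x| ^ (q + 1)) ^ ((1 - theta p q m) / (q + 1)) *
        (∫ x, |g x| ^ p) ^ (theta p q m / p)) := by
  have hQ := integral_abs_rpow_nonneg v (q + 1) (μ := volume)
  have hD := integral_abs_rpow_nonneg g p (μ := volume)
  rw [eLpNorm_ofReal_eq_ofReal_integral (by linarith) h.1,
    eLpNorm_ofReal_eq_ofReal_integral (by linarith) h.2.2,
    ENNReal.ofReal_rpow_of_nonneg (Real.rpow_nonneg hQ _) (one_sub_theta_pos hp hq hqm).le,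
    ENNReal.ofReal_rpow_of_nonneg (Real.rpow_nonneg hD _) (theta_pos hp hq hqm).le,
    ← Real.rpow_mul hQ, ← Real.rpow_mul hD, ← ENNReal.ofReal_mul hC,
    ← ENNReal.ofReal_mul (mul_nonneg hC (Real.rpow_nonneg hQ _)), one_div_mul_eq_div,
    one_div_mul_eq_div]

lemma eLpNorm_le_iff_gnInequality (hp : 1 < p) (hq : -1 < q) (hqm : q < m) (h : MemX p q v g)
    (hv : Continuous v) (hC : 0 ≤ C) :
    eLpNorm v (ENNReal.ofReal (m + 1)) volume ≤
      ENNReal.ofReal C * eLpNorm v (ENNReal.ofReal (q + 1)) volume ^ (1 - theta p q m) *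
        eLpNorm g (ENNReal.ofReal p) volume ^ theta p q m ↔ GNInequality p q m C v g := by
  have hm1 : 0 < m + 1 := by linarith
  rw [h.ofReal_mul_eLpNorm_rpow_eq hp hq hqm hC, eLpNorm_ofReal_eq_ofReal_integral hm1
    ((memLp_ofReal_iff_integrable_abs_rpow hv.aestronglyMeasurable hm1).2
      (h.integrable_abs_rpow_of_lt hp hq hqm hv)), ENNReal.ofReal_le_ofReal_iff, GNInequality]
  exact mul_nonneg (mul_nonneg hC (Real.rpow_nonneg (integral_abs_rpow_nonneg _ _) _))
    (Real.rpow_nonneg (integral_abs_rpow_nonneg _ _) _)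

end MemX

theorem constOfAction_mem_gnConstants (hp : 1 < p) (hq : -1 < q) (hqm : q < m) :
    constOfAction p q m (action p q m) ∈ gnConstants p q m := by
  have hC := (constOfAction_pos hp hq hqm (action_pos hp hq hqm)).le
  refine ⟨hC, fun u g h => ?_⟩
  obtain ⟨v, hv, huv⟩ := h.2.1.exists_continuous_ae_eq
  have hvg : MemX p q v g := ⟨h.1.ae_eq huv, h.2.1.congr_ae huv, h.2.2⟩
  rw [eLpNorm_congr_ae huv, eLpNorm_congr_ae huv,
    hvg.eLpNorm_le_iff_gnInequality hp hq hqm hv hC]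
  exact hvg.gnInequality hp hq hqm hv

end GagliardoNirenberg

section IncompleteBeta

variable {a b M k t : ℝ}

lemma ofReal_betaIntegrand (ht : t ∈ Icc (0 : ℝ) 1) :
    (t : ℂ) ^ ((a : ℂ) - 1) * (1 - (t : ℂ)) ^ ((b : ℂ) - 1) =
      ((t ^ (a - 1) * (1 - t) ^ (b - 1) : ℝ) : ℂ) := by
  rw [Complex.ofReal_mul, Complex.ofReal_cpow ht.1, Complex.ofReal_cpow (sub_nonneg.2 ht.2)]
  push_cast
  rfl

lemma intervalIntegrable_betaIntegrand (ha : 0 < a) (hb : 0 < b) :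
    IntervalIntegrable (fun t : ℝ => t ^ (a - 1) * (1 - t) ^ (b - 1)) volume 0 1 := by
  have h := Complex.betaIntegral_convergent (u := a) (v := b) (by simpa) (by simpa)
  rw [intervalIntegrable_iff, uIoc_of_le zero_le_one] at h ⊢
  refine h.re.congr ?_
  filter_upwards [ae_restrict_mem measurableSet_Ioc] with t ht
  rw [ofReal_betaIntegrand (Ioc_subset_Icc_self ht)]
  exact Complex.ofReal_re _

lemma incBeta_zero (a b : ℝ) : incBeta 0 a b = 0 := intervalIntegral.integral_same

lemma incBeta_one (ha : 0 < a) (hb : 0 < b) : incBeta 1 a b = ProbabilityTheory.beta a b := by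
  rw [ProbabilityTheory.beta_eq_betaIntegralReal a b ha hb, Complex.betaIntegral,
    intervalIntegral.integral_congr fun t ht =>
      ofReal_betaIntegrand (uIcc_of_le (zero_le_one' ℝ) ▸ ht),
    intervalIntegral.integral_ofReal, Complex.ofReal_re, incBeta]

lemma continuousOn_incBeta (ha : 0 < a) (hb : 0 < b) :
    ContinuousOn (fun x => incBeta x a b) (Icc 0 1) := by
  have := intervalIntegral.continuousOn_primitive_interval'
    (intervalIntegrable_betaIntegrand ha hb) (a := 0) left_mem_uIcc
  rwa [uIcc_of_le zero_le_one] at this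

lemma hasDerivAt_incBeta (ha : 0 < a) (hb : 0 < b) {x : ℝ} (hx : x ∈ Ioo (0 : ℝ) 1) :
    HasDerivAt (fun x => incBeta x a b) (x ^ (a - 1) * (1 - x) ^ (b - 1)) x := by
  have hc : ContinuousOn (fun t : ℝ => t ^ (a - 1) * (1 - t) ^ (b - 1)) (Ioo 0 1) :=
    (continuousOn_id.rpow_const fun t ht => Or.inl ht.1.ne').mul
      ((continuousOn_const.sub continuousOn_id).rpow_const
        fun t ht => Or.inl (sub_pos.2 ht.2).ne')
  refine intervalIntegral.integral_hasDerivAt_right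
    ((intervalIntegrable_betaIntegrand ha hb).mono_set ?_)
    (hc.stronglyMeasurableAtFilter isOpen_Ioo x hx) (hc.continuousAt (isOpen_Ioo.mem_nhds hx))
  rw [uIcc_of_le hx.1.le, uIcc_of_le zero_le_one]
  exact Icc_subset_Icc_right hx.2.le

lemma betaIntegrand_pos {x : ℝ} (hx : x ∈ Ioo (0 : ℝ) 1) : 0 < x ^ (a - 1) * (1 - x) ^ (b - 1) :=
  mul_pos (Real.rpow_pos_of_pos hx.1 _) (Real.rpow_pos_of_pos (sub_pos.2 hx.2) _)

lemma strictMonoOn_incBeta (ha : 0 < a) (hb : 0 < b) :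
    StrictMonoOn (fun x => incBeta x a b) (Icc 0 1) := by
  refine strictMonoOn_of_deriv_pos (convex_Icc 0 1) (continuousOn_incBeta ha hb) fun x hx => ?_
  rw [interior_Icc] at hx
  rw [(hasDerivAt_incBeta ha hb hx).deriv]
  exact betaIntegrand_pos hx

lemma incBetaInv_incBeta (ha : 0 < a) (hb : 0 < b) {x : ℝ} (hx : x ∈ Icc (0 : ℝ) 1) :
    incBetaInv (incBeta x a b) a b = x :=
  (strictMonoOn_incBeta ha hb).injOn.leftInvOn_invFunOn hx

lemma div_rpow_mem_Icc (hM : 0 < M) (hk : 0 < k) (ht : t ∈ Icc 0 M) :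
    (t / M) ^ k ∈ Icc (0 : ℝ) 1 :=
  ⟨Real.rpow_nonneg (div_nonneg ht.1 hM.le) _,
    Real.rpow_le_one (div_nonneg ht.1 hM.le) ((div_le_one hM).2 ht.2) hk.le⟩

lemma div_rpow_mem_Ioo (hM : 0 < M) (hk : 0 < k) (ht : t ∈ Ioo 0 M) :
    (t / M) ^ k ∈ Ioo (0 : ℝ) 1 :=
  ⟨Real.rpow_pos_of_pos (div_pos ht.1 hM) _,
    Real.rpow_lt_one (div_pos ht.1 hM).le ((div_lt_one hM).2 ht.2) hk⟩

lemma continuousOn_incBeta_div_rpow (ha : 0 < a) (hb : 0 < b) (hM : 0 < M) (hk : 0 < k) :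
    ContinuousOn (fun t => incBeta ((t / M) ^ k) a b) (Icc 0 M) :=
  (continuousOn_incBeta ha hb).comp
    ((continuous_id.div_const _).rpow_const fun _ => Or.inr hk.le).continuousOn
    fun _ => div_rpow_mem_Icc hM hk

lemma hasDerivAt_incBeta_div_rpow (ha : 0 < a) (hb : 0 < b) (hM : 0 < M) (hk : 0 < k)
    (ht : t ∈ Ioo 0 M) :
    HasDerivAt (fun t => incBeta ((t / M) ^ k) a b)
      (k / M * (t / M) ^ (k * a - 1) * (1 - (t / M) ^ k) ^ (b - 1)) t := by
  have hy : 0 < t / M := div_pos ht.1 hM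
  refine ((hasDerivAt_incBeta ha hb (div_rpow_mem_Ioo hM hk ht)).comp t
    (((hasDerivAt_id t).div_const M).rpow_const (Or.inl hy.ne'))).congr_deriv ?_
  have hexp : k * a - 1 = k * (a - 1) + (k - 1) := by ring
  simp only [id_eq]
  rw [← Real.rpow_mul hy.le, hexp, Real.rpow_add hy]
  ring

end IncompleteBeta

section Energy

/-- The value of `|u'|` at height `t` on a solution of the free boundary problem, as dictated by
conservation of energy. -/
noncomputable def speed (p q m t : ℝ) : ℝ := (p / (p - 1) * potential q m t) ^ (1 / p)

variable {p q m t R : ℝ} {u : ℝ → ℝ}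

lemma speed_nonneg (hp : 1 < p) (hq : -1 < q) (hqm : q < m) (ht : t ∈ Icc 0 (peak q m)) :
    0 ≤ speed p q m t :=
  Real.rpow_nonneg (mul_nonneg (div_nonneg (by linarith) (by linarith))
    (potential_nonneg hq hqm ht.1 ht.2)) _

lemma speed_pos (hp : 1 < p) (hq : -1 < q) (hqm : q < m) (ht : t ∈ Ioo 0 (peak q m)) :
    0 < speed p q m t :=
  Real.rpow_pos_of_pos (mul_pos (div_pos (by linarith) (by linarith))
    (potential_pos hq hqm ht.1 ht.2)) _

lemma speed_zero (hp : 1 < p) (hq : -1 < q) (hqm : q < m) : speed p q m 0 = 0 := by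
  rw [speed, potential_zero hq hqm, mul_zero, Real.zero_rpow (by positivity)]

lemma speed_peak (hp : 1 < p) (hq : -1 < q) (hqm : q < m) : speed p q m (peak q m) = 0 := by
  rw [speed, potential_peak hq hqm, mul_zero, Real.zero_rpow (by positivity)]

lemma speed_rpow (hp : 1 < p) (hq : -1 < q) (hqm : q < m) (ht : t ∈ Icc 0 (peak q m)) (r : ℝ) :
    speed p q m t ^ r = (p / (p - 1) * potential q m t) ^ (r / p) := by
  rw [speed, ← Real.rpow_mul (mul_nonneg (div_nonneg (by linarith) (by linarith))
    (potential_nonneg hq hqm ht.1 ht.2)), one_div_mul_eq_div]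

lemma momentum_eq_speed_rpow (hp : 1 < p) (hq : -1 < q) (hqm : q < m)
    (ht : t ∈ Icc 0 (peak q m)) : momentum p q m t = speed p q m t ^ (p - 1) := by
  rw [momentum_eq hq hqm ht.1 ht.2, speed_rpow hp hq hqm ht]

lemma speed_mul_momentum (hp : 1 < p) (hq : -1 < q) (hqm : q < m) (ht : t ∈ Icc 0 (peak q m)) :
    speed p q m t * momentum p q m t = speed p q m t ^ p := by
  rw [momentum_eq_speed_rpow hp hq hqm ht,
    ← Real.rpow_one_add' (speed_nonneg hp hq hqm ht) (by linarith), add_sub_cancel]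

lemma momentum_rpow_eq_speed_rpow (hp : 1 < p) (hq : -1 < q) (hqm : q < m)
    (ht : t ∈ Icc 0 (peak q m)) :
    momentum p q m t ^ (p / (p - 1)) = speed p q m t ^ p := by
  rw [momentum_eq_speed_rpow hp hq hqm ht, ← Real.rpow_mul (speed_nonneg hp hq hqm ht),
    mul_div_cancel₀ _ (by linarith)]

lemma continuous_speed (hp : 1 < p) (hq : -1 < q) (hqm : q < m) : Continuous (speed p q m) :=
  (continuous_const.mul (continuous_potential hq hqm)).rpow_const
    fun _ => Or.inr (one_div_nonneg.2 (by linarith))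

lemma hasDerivAt_potential (hq : -1 < q) (hqm : q < m) (ht : t ≠ 0) :
    HasDerivAt (potential q m) (t ^ q - t ^ m) t := by
  have hpow (r : ℝ) (hr : -1 < r) : HasDerivAt (fun t => t ^ (r + 1) / (r + 1)) (t ^ r) t := by
    have := (Real.hasDerivAt_rpow_const (p := r + 1) (Or.inl ht)).div_const (r + 1)
    rwa [add_sub_cancel_right, mul_div_cancel_left₀ _ (by linarith)] at this
  exact (hpow q hq).sub (hpow m (by linarith))

lemma eq_peak_of_potential_eq_zero (hq : -1 < q) (hqm : q < m) (ht : 0 < t)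
    (h : potential q m t = 0) : t = peak q m := by
  have hM := peak_pos hq hqm
  rw [potential_eq hq hqm ht.le] at h
  have hpow : (t / peak q m) ^ (m - q) = 1 := (sub_eq_zero.1 ((mul_eq_zero.1 h).resolve_left
    (div_pos (Real.rpow_pos_of_pos ht _) (by linarith)).ne')).symm
  rw [← Real.one_rpow (m - q), Real.rpow_left_inj (div_pos ht hM).le zero_le_one
    (by linarith)] at hpow
  exact (div_eq_one_iff_eq hM.ne').1 hpow

lemma one_lt_peak (hq : -1 < q) (hqm : q < m) : 1 < peak q m :=
  Real.one_lt_rpow ((one_lt_div (by linarith)).2 (by linarith)) (one_div_pos.2 (by linarith))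

lemma neg_abs_rpow_mul_self (hp : 1 < p) {d : ℝ} (hd : d ≤ 0) :
    -(|d| ^ (p - 2) * d) = (-d) ^ (p - 1) := by
  rcases hd.eq_or_lt with rfl | hd
  · rw [mul_zero, neg_zero, Real.zero_rpow (by linarith)]
  · rw [abs_of_neg hd, ← mul_neg, ← Real.rpow_add_one (neg_pos.2 hd).ne']
    congr 1
    ring

lemma hasDerivWithinAt_Icc_of_forall_Ioo {a b : ℝ} {D : ℝ → ℝ} (hab : a < b)
    (hu : ContinuousOn u (Icc a b)) (hD : ContinuousOn D (Icc a b))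
    (h : ∀ x ∈ Ioo a b, HasDerivAt u (D x) x) {x : ℝ} (hx : x ∈ Icc a b) :
    HasDerivWithinAt u (D x) (Icc a b) x := by
  rw [← closure_Ioo hab.ne] at hu hx ⊢
  refine hasFDerivWithinAt_closure_of_tendsto_fderiv
    (fun y hy => (h y hy).differentiableAt.differentiableWithinAt) (convex_Ioo a b) isOpen_Ioo
    (fun y hy => (hu y hy).mono subset_closure) ?_
  have hDx : Tendsto D (𝓝[Ioo a b] x) (𝓝 (D x)) :=
    (hD x (closure_Ioo hab.ne ▸ hx)).mono Ioo_subset_Icc_self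
  refine (((ContinuousLinearMap.toSpanSingletonCLE (𝕜 := ℝ) (E := ℝ)).continuous.tendsto _).comp
    hDx).congr' ?_
  filter_upwards [self_mem_nhdsWithin] with y hy using (h y hy).hasFDerivAt.fderiv.symm

lemma eq_zero_of_neg_deriv_rpow_eq {a b : ℝ} {F : ℝ → ℝ} (hp : 0 < p) (hab : a < b)
    (hu : ContinuousOn u (Icc a b)) (hF : ContinuousOn F (Icc a b))
    (hdiff : ∀ x ∈ Ioo a b, DifferentiableAt ℝ u x) (hanti : ∀ x ∈ Ioo a b, deriv u x ≤ 0)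
    (h : ∀ x ∈ Ioo a b, (-deriv u x) ^ p = F x) {x : ℝ} (hx : x ∈ Icc a b)
    (hux : HasDerivAt u 0 x) : F x = 0 := by
  have hD : ContinuousOn (fun x => -|F x| ^ (1 / p)) (Icc a b) :=
    (hF.abs.rpow_const fun _ _ => Or.inr (one_div_pos.2 hp).le).neg
  have hderiv : ∀ x ∈ Ioo a b, HasDerivAt u (-|F x| ^ (1 / p)) x := fun x hx => by
    have hnonneg : 0 ≤ -deriv u x := neg_nonneg.2 (hanti x hx)
    rw [← h x hx, abs_of_nonneg (Real.rpow_nonneg hnonneg _), ← Real.rpow_mul hnonneg,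
      mul_one_div_cancel hp.ne', Real.rpow_one, neg_neg]
    exact (hdiff x hx).hasDerivAt
  have hzero := (uniqueDiffOn_Icc hab x hx).eq_deriv _
    (hasDerivWithinAt_Icc_of_forall_Ioo hab hu hD hderiv hx) hux.hasDerivWithinAt
  rwa [neg_eq_zero, Real.rpow_eq_zero (abs_nonneg _) (one_div_pos.2 hp).ne', abs_eq_zero] at hzero

namespace IsFreeBoundarySolution

lemma continuousOn (h : IsFreeBoundarySolution p q m u R) : ContinuousOn u (Icc 0 R) := by
  refine fun r hr => ContinuousAt.continuousWithinAt ?_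
  rcases hr.1.eq_or_lt with rfl | h0
  · exact h.deriv_origin.continuousAt
  rcases hr.2.eq_or_lt with rfl | hR
  · exact h.deriv_radius.continuousAt
  · exact (h.differentiable r ⟨h0, hR⟩).continuousAt

lemma deriv_nonpos (h : IsFreeBoundarySolution p q m u R) {r : ℝ} (hr : r ∈ Ioo 0 R) :
    deriv u r ≤ 0 := by
  have hanti : AntitoneOn u (Ioo 0 R) := h.mem.2.2.1.mono fun x hx => hx.1.le
  exact derivWithin_of_isOpen (f := u) isOpen_Ioo hr ▸ hanti.derivWithin_nonpos

lemma exists_energy (hp : 1 < p) (hq : -1 < q) (hqm : q < m)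
    (h : IsFreeBoundarySolution p q m u R) :
    ∃ e, ∀ r ∈ Ioo 0 R, (-deriv u r) ^ p = p / (p - 1) * (e + potential q m (u r)) := by
  have hp1 : 0 < p - 1 := by linarith
  obtain ⟨w, hw⟩ : ∃ w : ℝ → ℝ, w = fun s => |deriv u s| ^ (p - 2) * deriv u s := ⟨_, rfl⟩
  have hw_rpow : ∀ r ∈ Ioo 0 R, ∀ k, (-w r) ^ k = (-deriv u r) ^ ((p - 1) * k) := fun r hr k => by
    rw [hw, neg_abs_rpow_mul_self hp (h.deriv_nonpos hr),
      ← Real.rpow_mul (neg_nonneg.2 (h.deriv_nonpos hr))]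
  have hderiv : ∀ r ∈ Ioo 0 R, HasDerivAt
      (fun s => (-w s) ^ (p / (p - 1)) * ((p - 1) / p) - potential q m (u s)) 0 r := fun r hr => by
    obtain ⟨hd, heq⟩ := hw ▸ h.equation r hr
    have hkinetic := (hd.hasDerivAt.neg.rpow_const (p := p / (p - 1))
      (Or.inr ((one_le_div hp1).2 (by linarith)))).mul_const ((p - 1) / p)
    have hpot := (hasDerivAt_potential hq hqm (h.pos r ⟨hr.1.le, hr.2⟩).ne').comp r
      (h.differentiable r hr).hasDerivAt
    refine (hkinetic.sub hpot).congr_deriv ?_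
    have hexp : (p - 1) * (p / (p - 1) - 1) = 1 := by field_simp; ring
    rw [Pi.neg_apply, hw_rpow r hr, hexp, Real.rpow_one, eq_sub_of_add_eq heq]
    field_simp
    ring
  obtain ⟨e, he⟩ := isOpen_Ioo.exists_is_const_of_deriv_eq_zero isPreconnected_Ioo
    (fun r hr => (hderiv r hr).differentiableAt.differentiableWithinAt)
    (fun r hr => (hderiv r hr).deriv)
  refine ⟨e, fun r hr => ?_⟩
  rw [← he r hr, hw_rpow r hr, mul_div_cancel₀ _ hp1.ne']
  field_simp
  ring

/-- The energy vanishes at the free boundary, where both `u` and `u'` do; it then determines the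
height at the origin, where only `u'` vanishes. -/
lemma neg_deriv_rpow_eq_and_origin (hp : 1 < p) (hq : -1 < q) (hqm : q < m)
    (h : IsFreeBoundarySolution p q m u R) :
    (∀ r ∈ Ioo 0 R, (-deriv u r) ^ p = p / (p - 1) * potential q m (u r)) ∧
      u 0 = peak q m := by
  have hR := h.radius_pos
  have hpp : p / (p - 1) ≠ 0 := (div_pos (by linarith) (by linarith)).ne'
  obtain ⟨e, he⟩ := h.exists_energy hp hq hqm
  have hzero {r : ℝ} (hr : r ∈ Icc 0 R) (hur : HasDerivAt u 0 r) :
      e + potential q m (u r) = 0 :=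
    (mul_eq_zero.1 (eq_zero_of_neg_deriv_rpow_eq (by linarith) hR h.continuousOn
      (continuousOn_const.mul (continuousOn_const.add
        ((continuous_potential hq hqm).comp_continuousOn h.continuousOn)))
      h.differentiable (fun _ => h.deriv_nonpos) he hr hur)).resolve_left hpp
  have heR : e = 0 := by
    simpa only [h.zero R le_rfl, potential_zero hq hqm, add_zero] using
      hzero (right_mem_Icc.2 hR.le) h.deriv_radius
  refine ⟨fun r hr => by rw [he r hr, heR, zero_add],
    eq_peak_of_potential_eq_zero hq hqm (h.pos 0 ⟨le_rfl, hR⟩) ?_⟩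
  simpa only [heR, zero_add] using hzero (left_mem_Icc.2 hR.le) h.deriv_origin

/-- A solution that stays at its peak would be constant there, but the only positive constant
solution is `1`. -/
lemma lt_peak (hq : -1 < q) (hqm : q < m) (h : IsFreeBoundarySolution p q m u R)
    (h0 : u 0 = peak q m) {r : ℝ} (hr : r ∈ Ioo 0 R) : u r < peak q m := by
  have hanti := h.mem.2.2.1
  have hle {s : ℝ} (hs : 0 ≤ s) : u s ≤ peak q m := h0 ▸ hanti self_mem_Ici hs hs
  refine (hle hr.1.le).lt_of_ne fun hur => ?_
  have hconst : ∀ s ∈ Ioo 0 r, u s = peak q m := fun s hs =>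
    (hle hs.1.le).antisymm (hur ▸ hanti hs.1.le hr.1.le hs.2.le)
  have hderiv : ∀ s ∈ Ioo 0 r, deriv u s = 0 := fun s hs => by
    have hev : u =ᶠ[𝓝 s] fun _ => peak q m :=
      eventually_of_mem (isOpen_Ioo.mem_nhds hs) hconst
    rw [hev.deriv_eq, deriv_const]
  have hs : r / 2 ∈ Ioo 0 r := ⟨half_pos hr.1, half_lt_self hr.1⟩
  have hflux : (fun s => |deriv u s| ^ (p - 2) * deriv u s) =ᶠ[𝓝 (r / 2)] fun _ => 0 :=
    eventually_of_mem (isOpen_Ioo.mem_nhds hs) fun x hx => by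
      simp only [hderiv x hx, mul_zero]
  have heq := (h.equation (r / 2) ⟨hs.1, hs.2.trans hr.2⟩).2
  rw [hflux.deriv_eq, deriv_const, zero_add, hconst _ hs] at heq
  exact (Real.rpow_lt_rpow_of_exponent_lt (one_lt_peak hq hqm) hqm).ne' heq

end IsFreeBoundarySolution

end Energy

section Profile

/-- A compactly supported even function which decreases from `peak q m` to `0` on `[0, R]` with the
speed prescribed by the vanishing of the energy: the first-order form of the free boundary
problem. -/
structure IsProfile (p q m : ℝ) (u : ℝ → ℝ) (R : ℝ) : Prop where
  radius_pos : 0 < R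
  even : ∀ x, u x = u |x|
  zero : ∀ r, R ≤ r → u r = 0
  continuousOn : ContinuousOn u (Icc 0 R)
  origin : u 0 = peak q m
  mem : ∀ r ∈ Ioo 0 R, u r ∈ Ioo 0 (peak q m)
  hasDerivAt : ∀ r ∈ Ioo 0 R, HasDerivAt u (-speed p q m (u r)) r

variable {p q m R : ℝ} {u : ℝ → ℝ}

theorem IsFreeBoundarySolution.isProfile (hp : 1 < p) (hq : -1 < q) (hqm : q < m)
    (h : IsFreeBoundarySolution p q m u R) : IsProfile p q m u R := by
  obtain ⟨henergy, h0⟩ := h.neg_deriv_rpow_eq_and_origin hp hq hqm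
  refine ⟨h.radius_pos, h.mem.2.1, h.zero, h.continuousOn, h0,
    fun r hr => ⟨h.pos r ⟨hr.1.le, hr.2⟩, h.lt_peak hq hqm h0 hr⟩, fun r hr => ?_⟩
  rw [speed, ← henergy r hr, ← Real.rpow_mul (neg_nonneg.2 (h.deriv_nonpos hr)),
    mul_one_div_cancel (by linarith), Real.rpow_one, neg_neg]
  exact (h.differentiable r hr).hasDerivAt

lemma hasDerivAt_of_hasDerivAt_off_countable {f g : ℝ → ℝ} {s : Set ℝ} (hs : s.Countable)
    (hf : Continuous f) (hg : Continuous g) (h : ∀ x, x ∉ s → HasDerivAt f (g x) x) (x : ℝ) :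
    HasDerivAt f (g x) x := by
  have hprim : f = fun y => f 0 + ∫ t in (0 : ℝ)..y, g t := funext fun y => by
    rw [integral_eq_of_hasDerivAt_off_countable f g hs hf.continuousOn
      (fun x hx => h x hx.2) (hg.intervalIntegrable _ _), add_sub_cancel]
  exact hprim ▸ (hasDerivAt_primitive_of_continuous hg 0 x).const_add _

namespace IsProfile

lemma continuous (h : IsProfile p q m u R) : Continuous u := by
  have hright : ContinuousOn u (Ici R) := continuousOn_const.congr h.zero
  have hIci := h.continuousOn.union_of_isClosed hright isClosed_Icc isClosed_Ici
  rw [Icc_union_Ici_eq_Ici h.radius_pos.le] at hIci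
  exact (hIci.comp_continuous continuous_abs fun x => abs_nonneg x).congr fun x => (h.even x).symm

lemma mem_Icc (hq : -1 < q) (hqm : q < m) (h : IsProfile p q m u R) (x : ℝ) :
    u x ∈ Icc 0 (peak q m) := by
  have hM := (peak_pos hq hqm).le
  rw [h.even]
  rcases (abs_nonneg x).eq_or_lt with h0 | h0
  · rw [← h0, h.origin]
    exact right_mem_Icc.2 hM
  rcases lt_or_ge |x| R with hxR | hxR
  · exact Ioo_subset_Icc_self (h.mem _ ⟨h0, hxR⟩)
  · rw [h.zero _ hxR]
    exact left_mem_Icc.2 hM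

lemma hasDerivAt_of_pos_of_ne (hp : 1 < p) (hq : -1 < q) (hqm : q < m) (h : IsProfile p q m u R)
    {x : ℝ} (hx : 0 < x) (hxR : x ≠ R) : HasDerivAt u (-speed p q m (u x)) x := by
  rcases hxR.lt_or_gt with hlt | hgt
  · exact h.hasDerivAt x ⟨hx, hlt⟩
  · rw [h.zero x hgt.le, speed_zero hp hq hqm, neg_zero]
    exact (hasDerivAt_const x 0).congr_of_eventuallyEq
      (eventually_of_mem (Ioi_mem_nhds hgt) fun z hz => h.zero z (le_of_lt hz))

lemma continuous_slope (hp : 1 < p) (hq : -1 < q) (hqm : q < m) (h : IsProfile p q m u R) :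
    Continuous fun x => if x ≤ 0 then speed p q m (u x) else -speed p q m (u x) := by
  have hspeed := (continuous_speed hp hq hqm).comp h.continuous
  refine Continuous.if_le hspeed hspeed.neg continuous_id continuous_const fun x hx => ?_
  rw [show x = 0 from hx, h.origin, speed_peak hp hq hqm, neg_zero]

lemma hasDerivAt_line (hp : 1 < p) (hq : -1 < q) (hqm : q < m) (h : IsProfile p q m u R) (x : ℝ) :
    HasDerivAt u (if x ≤ 0 then speed p q m (u x) else -speed p q m (u x)) x := by
  refine hasDerivAt_of_hasDerivAt_off_countable (s := {0, R, -R})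
    (g := fun x => if x ≤ 0 then speed p q m (u x) else -speed p q m (u x))
    (by simp) h.continuous (h.continuous_slope hp hq hqm) (fun y hy => ?_) x
  simp only [mem_insert_iff, mem_singleton_iff, not_or] at hy
  obtain ⟨hy0, hyR, hynR⟩ := hy
  rcases lt_or_gt_of_ne hy0 with hlt | hgt
  · have heven : ∀ z, u (-z) = u z := fun z => by rw [h.even, abs_neg, ← h.even]
    have hright := (h.hasDerivAt_of_pos_of_ne hp hq hqm (neg_pos.2 hlt)
      fun hR => hynR (by rw [← hR, neg_neg])).comp y (hasDerivAt_neg y)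
    rw [show u ∘ Neg.neg = u from funext heven, heven, mul_neg_one, neg_neg] at hright
    rwa [if_pos hlt.le]
  · rw [if_neg hgt.not_ge]
    exact h.hasDerivAt_of_pos_of_ne hp hq hqm hgt hyR

lemma abs_deriv (hp : 1 < p) (hq : -1 < q) (hqm : q < m) (h : IsProfile p q m u R) (x : ℝ) :
    |deriv u x| = speed p q m (u x) := by
  have hspeed := speed_nonneg hp hq hqm (h.mem_Icc hq hqm x)
  rw [(h.hasDerivAt_line hp hq hqm x).deriv]
  split_ifs
  · exact abs_of_nonneg hspeed
  · rw [abs_neg, abs_of_nonneg hspeed]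

lemma hasCompactSupport (h : IsProfile p q m u R) : HasCompactSupport u :=
  HasCompactSupport.intro (isCompact_Icc (a := -R) (b := R)) fun x hx => by
    rw [h.even, h.zero _ (le_of_not_gt fun hlt => hx (abs_le.1 hlt.le))]

lemma continuous_deriv (hp : 1 < p) (hq : -1 < q) (hqm : q < m) (h : IsProfile p q m u R) :
    Continuous (deriv u) :=
  (h.continuous_slope hp hq hqm).congr fun x => (h.hasDerivAt_line hp hq hqm x).deriv.symm

lemma memX (hp : 1 < p) (hq : -1 < q) (hqm : q < m) (h : IsProfile p q m u R) :
    MemX p q u (deriv u) :=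
  ⟨h.continuous.memLp_of_hasCompactSupport h.hasCompactSupport,
    hasWeakDeriv_of_hasDerivAt
      (fun x => (h.hasDerivAt_line hp hq hqm x).differentiableAt.hasDerivAt)
      (h.continuous_deriv hp hq hqm),
    (h.continuous_deriv hp hq hqm).memLp_of_hasCompactSupport h.hasCompactSupport.deriv⟩

lemma memXRad (hp : 1 < p) (hq : -1 < q) (hqm : q < m) (h : IsProfile p q m u R) :
    MemXRad p q u := by
  have hderiv := h.hasDerivAt_line hp hq hqm
  refine ⟨fun x => (h.mem_Icc hq hqm x).1, h.even, ?_, _, h.memX hp hq hqm⟩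
  refine antitoneOn_of_deriv_nonpos (convex_Ici 0) h.continuous.continuousOn
    (fun x _ => (hderiv x).differentiableAt.differentiableWithinAt) fun x hx => ?_
  rw [interior_Ici] at hx
  rw [(hderiv x).deriv, if_neg (not_le.2 hx)]
  exact neg_nonpos.2 (speed_nonneg hp hq hqm (h.mem_Icc hq hqm x))

lemma hasDerivAt_neg_momentum (hp : 1 < p) (hq : -1 < q) (hqm : q < m) (h : IsProfile p q m u R)
    {r : ℝ} (hr : r ∈ Ioo 0 R) :
    HasDerivAt (fun s => -momentum p q m (u s)) (u r ^ q - u r ^ m) r := by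
  have hp1 : 0 < p - 1 := by linarith
  have hur := h.mem r hr
  have hpos : 0 < p / (p - 1) * potential q m (u r) :=
    mul_pos (div_pos (by linarith) hp1) (potential_pos hq hqm hur.1 hur.2)
  have hchain : HasDerivAt (fun s => p / (p - 1) * potential q m (u s)) _ r :=
    ((hasDerivAt_potential hq hqm hur.1.ne').comp r (h.hasDerivAt r hr)).const_mul (p / (p - 1))
  have hmomentum (s : ℝ) :=
    momentum_eq (p := p) hq hqm (h.mem_Icc hq hqm s).1 (h.mem_Icc hq hqm s).2
  simp_rw [hmomentum]
  refine (hchain.rpow_const (p := (p - 1) / p) (Or.inl hpos.ne')).neg.congr_deriv ?_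
  have hexp : (p - 1) / p - 1 = -(1 / p) := by field_simp; ring
  have hspeed : speed p q m (u r) ≠ 0 := (Real.rpow_pos_of_pos hpos _).ne'
  rw [hexp, Real.rpow_neg hpos.le, ← speed]
  field_simp

lemma flux_eq_neg_momentum (hp : 1 < p) (hq : -1 < q) (hqm : q < m) (h : IsProfile p q m u R)
    {r : ℝ} (hr : r ∈ Ioo 0 R) :
    |deriv u r| ^ (p - 2) * deriv u r = -momentum p q m (u r) := by
  have hur := h.mem_Icc hq hqm r
  rw [(h.hasDerivAt r hr).deriv, momentum_eq_speed_rpow hp hq hqm hur, ← neg_neg (_ * _),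
    neg_abs_rpow_mul_self hp (neg_nonpos.2 (speed_nonneg hp hq hqm hur)), neg_neg]

theorem isFreeBoundarySolution (hp : 1 < p) (hq : -1 < q) (hqm : q < m)
    (h : IsProfile p q m u R) : IsFreeBoundarySolution p q m u R where
  radius_pos := h.radius_pos
  mem := h.memXRad hp hq hqm
  pos r hr := by
    rcases hr.1.eq_or_lt with rfl | h0
    · exact h.origin ▸ peak_pos hq hqm
    · exact (h.mem r ⟨h0, hr.2⟩).1
  zero := h.zero
  differentiable r hr := (h.hasDerivAt r hr).differentiableAt
  equation r hr := by
    have hflux := (h.hasDerivAt_neg_momentum hp hq hqm hr).congr_of_eventuallyEq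
      (eventually_of_mem (isOpen_Ioo.mem_nhds hr) fun s => h.flux_eq_neg_momentum hp hq hqm)
    exact ⟨hflux.differentiableAt, by rw [hflux.deriv, sub_add_cancel]⟩
  deriv_origin := by
    simpa only [le_refl, if_true, h.origin, speed_peak hp hq hqm] using
      h.hasDerivAt_line hp hq hqm 0
  deriv_radius := by
    simpa only [h.radius_pos.not_ge, if_false, h.zero R le_rfl, speed_zero hp hq hqm, neg_zero]
      using h.hasDerivAt_line hp hq hqm R

end IsProfile

end Profile

section Travel

lemma continuousOn_invFunOn_image {α β : Type*} [TopologicalSpace α] [TopologicalSpace β]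
    [T2Space β] [Nonempty α] {f : α → β} {s : Set α} (hs : IsCompact s) (hf : ContinuousOn f s)
    (hinj : InjOn f s) : ContinuousOn (Function.invFunOn f s) (f '' s) := by
  refine continuousOn_iff_isClosed.2 fun t ht => ⟨f '' (t ∩ s),
    ((hs.inter_left ht).image_of_continuousOn (hf.mono inter_subset_right)).isClosed, ?_⟩
  ext y
  refine and_congr_left fun hy => ?_
  obtain ⟨x, hx, rfl⟩ := hy
  rw [mem_preimage, hinj.leftInvOn_invFunOn hx]
  exact ⟨fun hxt => ⟨x, ⟨hxt, hx⟩, rfl⟩, fun ⟨z, hz, hzx⟩ => hinj hz.2 hx hzx ▸ hz.1⟩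

lemma beta_comm (a b : ℝ) : ProbabilityTheory.beta a b = ProbabilityTheory.beta b a := by
  rw [ProbabilityTheory.beta, ProbabilityTheory.beta, mul_comm, add_comm]

variable {p q m t : ℝ}

lemma log_peak (hq : -1 < q) (hqm : q < m) :
    Real.log (peak q m) = (Real.log (m + 1) - Real.log (q + 1)) / (m - q) := by
  rw [peak, Real.log_rpow (div_pos (by linarith) (by linarith)),
    Real.log_div (by linarith) (by linarith), one_div_mul_eq_div]

lemma cBar_pos (hp : 1 < p) (hq : -1 < q) (hqm : q < m) : 0 < cBar p q m := by
  have hm : 0 < m + 1 := by linarith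
  have hq1 : 0 < q + 1 := by linarith
  unfold cBar
  positivity

lemma log_cBar (hp : 1 < p) (hq : -1 < q) (hqm : q < m) :
    Real.log (cBar p q m) = 1 / p * (Real.log p - Real.log (p - 1)) + Real.log (m - q) +
      (1 + q - p) / (p * (m - q)) * Real.log (m + 1) +
      (p - m - 1) / (p * (m - q)) * Real.log (q + 1) := by
  have hp0 : 0 < p := by linarith
  have hp1 : 0 < p - 1 := by linarith
  have hm : 0 < m + 1 := by linarith
  have hq1 : 0 < q + 1 := by linarith
  rw [cBar, Real.log_mul (by positivity) (by positivity),
    Real.log_mul (by positivity) (by positivity), Real.log_mul (by positivity) (by positivity),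
    Real.log_rpow (by positivity), Real.log_rpow hm, Real.log_rpow hq1,
    Real.log_div hp0.ne' hp1.ne']

lemma betaParam_pos (hp : 0 < p) (hqp : q < p - 1) (hqm : q < m) :
    0 < (p - 1 - q) / (p * (m - q)) :=
  div_pos (by linarith) (mul_pos hp (by linarith))

lemma one_sub_one_div_pos (hp : 1 < p) : 0 < 1 - 1 / p := by
  rw [sub_pos, div_lt_one (by linarith)]
  exact hp

lemma radius_eq_beta_div_cBar (hp : 1 < p) (hq : -1 < q) (hqp : q < p - 1) (hqm : q < m) :
    radius p q m =
      ProbabilityTheory.beta ((p - 1 - q) / (p * (m - q))) (1 - 1 / p) / cBar p q m := by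
  have hp0 : 0 < p := by linarith
  have hp1 : 0 < p - 1 := by linarith
  have hmq : 0 < m - q := by linarith
  have hm : 0 < m + 1 := by linarith
  have hq1 : 0 < q + 1 := by linarith
  have hc := cBar_pos hp hq hqm
  have hbeta := ProbabilityTheory.beta_pos (betaParam_pos hp0 hqp hqm) (one_sub_one_div_pos hp)
  rw [radius, ← sub_sub p q 1, sub_right_comm p q 1, beta_comm (1 - 1 / p)]
  refine Real.log_injOn_pos (mem_Ioi.2 (by positivity)) (mem_Ioi.2 (by positivity)) ?_
  rw [Real.log_div hbeta.ne' hc.ne', log_cBar hp hq hqm,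
    Real.log_mul (by positivity) hbeta.ne', Real.log_mul (by positivity) (by positivity),
    Real.log_div (by positivity) hmq.ne', Real.log_mul (by positivity) (by positivity),
    Real.log_rpow (by positivity), Real.log_rpow hm, Real.log_rpow hq1,
    Real.log_div hp1.ne' hp0.ne']
  field_simp
  ring

lemma radius_pos (hp : 1 < p) (hq : -1 < q) (hqp : q < p - 1) (hqm : q < m) :
    0 < radius p q m := by
  rw [radius_eq_beta_div_cBar hp hq hqp hqm]
  exact div_pos (ProbabilityTheory.beta_pos (betaParam_pos (by linarith) hqp hqm)
    (one_sub_one_div_pos hp)) (cBar_pos hp hq hqm)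

/-- The distance `∫_0^t dτ / speed τ` from the free boundary at which a profile has height `t`; the
substitution `s = (τ / peak)^(m - q)` turns the integral into an incomplete Beta function. -/
noncomputable def travel (p q m t : ℝ) : ℝ :=
  incBeta ((t / peak q m) ^ (m - q)) ((p - 1 - q) / (p * (m - q))) (1 - 1 / p) / cBar p q m

/-- The height of a profile at distance `y` from its free boundary: the inverse of `travel`. -/
noncomputable def height (p q m y : ℝ) : ℝ :=
  Function.invFunOn (travel p q m) (Icc 0 (peak q m)) y

lemma travel_zero (hqm : q < m) : travel p q m 0 = 0 := by
  rw [travel, zero_div, Real.zero_rpow (by linarith), incBeta_zero, zero_div]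

lemma travel_peak (hp : 1 < p) (hq : -1 < q) (hqp : q < p - 1) (hqm : q < m) :
    travel p q m (peak q m) = radius p q m := by
  rw [travel, div_self (peak_pos hq hqm).ne', Real.one_rpow,
    incBeta_one (betaParam_pos (by linarith) hqp hqm) (one_sub_one_div_pos hp),
    radius_eq_beta_div_cBar hp hq hqp hqm]

lemma continuousOn_travel (hp : 1 < p) (hq : -1 < q) (hqp : q < p - 1) (hqm : q < m) :
    ContinuousOn (travel p q m) (Icc 0 (peak q m)) :=
  (continuousOn_incBeta_div_rpow (betaParam_pos (by linarith) hqp hqm) (one_sub_one_div_pos hp)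
    (peak_pos hq hqm) (sub_pos.2 hqm)).div_const _

lemma hasDerivAt_travel (hp : 1 < p) (hq : -1 < q) (hqp : q < p - 1) (hqm : q < m)
    (ht : t ∈ Ioo 0 (peak q m)) : HasDerivAt (travel p q m) (speed p q m t)⁻¹ t := by
  have hp0 : 0 < p := by linarith
  have hp1 : 0 < p - 1 := by linarith
  have hmq : 0 < m - q := by linarith
  have hq1 : 0 < q + 1 := by linarith
  have hM := peak_pos hq hqm
  have hc := cBar_pos hp hq hqm
  have hspeed := speed_pos hp hq hqm ht
  have ht0 := ht.1
  have hs : 0 < 1 - (t / peak q m) ^ (m - q) := sub_pos.2 (div_rpow_mem_Ioo hM hmq ht).2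
  refine ((hasDerivAt_incBeta_div_rpow (betaParam_pos hp0 hqp hqm) (one_sub_one_div_pos hp) hM
    hmq ht).div_const _).congr_deriv ?_
  refine Real.log_injOn_pos (mem_Ioi.2 (by positivity)) (mem_Ioi.2 (by positivity)) ?_
  rw [Real.log_div (by positivity) hc.ne', Real.log_mul (by positivity) (by positivity),
    Real.log_mul (by positivity) (by positivity), Real.log_rpow (by positivity),
    Real.log_rpow hs, Real.log_div hmq.ne' hM.ne', Real.log_inv, speed,
    Real.log_rpow (mul_pos (by positivity) (potential_pos hq hqm ht0 ht.2)),
    potential_eq hq hqm ht0.le, Real.log_mul (by positivity) (by positivity),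
    Real.log_mul (by positivity) hs.ne', Real.log_div (by positivity) hq1.ne',
    Real.log_rpow ht0, Real.log_div hp0.ne' hp1.ne', Real.log_div ht0.ne' hM.ne',
    log_cBar hp hq hqm, log_peak hq hqm]
  field_simp
  ring

lemma strictMonoOn_travel (hp : 1 < p) (hq : -1 < q) (hqp : q < p - 1) (hqm : q < m) :
    StrictMonoOn (travel p q m) (Icc 0 (peak q m)) := by
  refine strictMonoOn_of_deriv_pos (convex_Icc _ _) (continuousOn_travel hp hq hqp hqm)
    fun t ht => ?_
  rw [interior_Icc] at ht
  rw [(hasDerivAt_travel hp hq hqp hqm ht).deriv]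
  exact inv_pos.2 (speed_pos hp hq hqm ht)

lemma image_travel_Icc (hp : 1 < p) (hq : -1 < q) (hqp : q < p - 1) (hqm : q < m) :
    travel p q m '' Icc 0 (peak q m) = Icc 0 (radius p q m) := by
  rw [(continuousOn_travel hp hq hqp hqm).image_Icc_of_monotoneOn (peak_pos hq hqm).le
    (strictMonoOn_travel hp hq hqp hqm).monotoneOn, travel_zero hqm, travel_peak hp hq hqp hqm]

lemma height_travel (hp : 1 < p) (hq : -1 < q) (hqp : q < p - 1) (hqm : q < m)
    (ht : t ∈ Icc 0 (peak q m)) : height p q m (travel p q m t) = t :=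
  (strictMonoOn_travel hp hq hqp hqm).injOn.leftInvOn_invFunOn ht

lemma continuousOn_height (hp : 1 < p) (hq : -1 < q) (hqp : q < p - 1) (hqm : q < m) :
    ContinuousOn (height p q m) (Icc 0 (radius p q m)) :=
  image_travel_Icc hp hq hqp hqm ▸ continuousOn_invFunOn_image isCompact_Icc
    (continuousOn_travel hp hq hqp hqm) (strictMonoOn_travel hp hq hqp hqm).injOn

lemma height_mem_Ioo_and_travel_height (hp : 1 < p) (hq : -1 < q) (hqp : q < p - 1) (hqm : q < m)
    {y : ℝ} (hy : y ∈ Ioo 0 (radius p q m)) :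
    height p q m y ∈ Ioo 0 (peak q m) ∧ travel p q m (height p q m y) = y := by
  obtain ⟨t, ht, rfl⟩ : y ∈ travel p q m '' Icc 0 (peak q m) :=
    image_travel_Icc hp hq hqp hqm ▸ Ioo_subset_Icc_self hy
  rw [height_travel hp hq hqp hqm ht]
  refine ⟨⟨ht.1.lt_of_ne ?_, ht.2.lt_of_ne ?_⟩, rfl⟩ <;> rintro rfl
  · exact hy.1.ne' (travel_zero hqm)
  · exact hy.2.ne (travel_peak hp hq hqp hqm)

lemma hasDerivAt_height (hp : 1 < p) (hq : -1 < q) (hqp : q < p - 1) (hqm : q < m)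
    {y : ℝ} (hy : y ∈ Ioo 0 (radius p q m)) :
    HasDerivAt (height p q m) (speed p q m (height p q m y)) y := by
  have hmem {z : ℝ} (hz : z ∈ Ioo 0 (radius p q m)) :=
    height_mem_Ioo_and_travel_height hp hq hqp hqm hz
  rw [← inv_inv (speed _ _ _ _)]
  exact HasDerivAt.of_local_left_inverse
    ((continuousOn_height hp hq hqp hqm).continuousAt (Icc_mem_nhds hy.1 hy.2))
    (hasDerivAt_travel hp hq hqp hqm (hmem hy).1)
    (inv_pos.2 (speed_pos hp hq hqm (hmem hy).1)).ne'
    (eventually_of_mem (isOpen_Ioo.mem_nhds hy) fun z hz => (hmem hz).2)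

theorem isProfile_height (hp : 1 < p) (hq : -1 < q) (hqp : q < p - 1) (hqm : q < m) :
    IsProfile p q m (fun x => height p q m (max (radius p q m - |x|) 0)) (radius p q m) := by
  have hM := (peak_pos hq hqm).le
  have hR := radius_pos hp hq hqp hqm
  have hIoo {r : ℝ} (hr : r ∈ Ioo 0 (radius p q m)) :
      max (radius p q m - |r|) 0 = radius p q m - r := by
    rw [abs_of_pos hr.1, max_eq_left (by linarith [hr.2])]
  have hsub {r : ℝ} (hr : r ∈ Ioo 0 (radius p q m)) :
      radius p q m - r ∈ Ioo 0 (radius p q m) := ⟨by linarith [hr.2], by linarith [hr.1]⟩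
  refine ⟨hR, fun x => by rw [abs_abs], fun r hr => ?_, ?_, ?_, fun r hr => ?_, fun r hr => ?_⟩
  · simpa only [max_eq_right (show radius p q m - |r| ≤ 0 by linarith [le_abs_self r]),
      travel_zero hqm] using height_travel hp hq hqp hqm (left_mem_Icc.2 hM)
  · exact (continuousOn_height hp hq hqp hqm).comp (by fun_prop) fun r _ =>
      ⟨le_max_right _ _, max_le (by linarith [abs_nonneg r]) hR.le⟩
  · rw [abs_zero, sub_zero, max_eq_left hR.le, ← travel_peak hp hq hqp hqm,
      height_travel hp hq hqp hqm (right_mem_Icc.2 hM)]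
  · rw [hIoo hr]
    exact (height_mem_Ioo_and_travel_height hp hq hqp hqm (hsub hr)).1
  · have hev : (fun x => height p q m (max (radius p q m - |x|) 0)) =ᶠ[𝓝 r]
        fun x => height p q m (radius p q m - x) :=
      eventually_of_mem (isOpen_Ioo.mem_nhds hr) fun x hx => by simp only [hIoo hx]
    rw [hIoo hr]
    exact ((hasDerivAt_height hp hq hqp hqm (hsub hr)).comp_const_sub _ r).congr_of_eventuallyEq hev

namespace IsProfile

variable {R r : ℝ} {u : ℝ → ℝ}

lemma travel_eq (hp : 1 < p) (hq : -1 < q) (hqp : q < p - 1) (hqm : q < m)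
    (h : IsProfile p q m u R) (hr : r ∈ Icc 0 R) : travel p q m (u r) = R - r := by
  have hcont : ContinuousOn (fun x => travel p q m (u x)) (Icc r R) :=
    (continuousOn_travel hp hq hqp hqm).comp h.continuous.continuousOn
      fun x _ => h.mem_Icc hq hqm x
  have hderiv : ∀ x ∈ Ioo r R, HasDerivAt (fun x => travel p q m (u x)) (-1) x := fun x hx => by
    have hx' : x ∈ Ioo 0 R := ⟨hr.1.trans_lt hx.1, hx.2⟩
    have hchain := (hasDerivAt_travel hp hq hqp hqm (h.mem x hx')).comp x (h.hasDerivAt x hx')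
    rwa [mul_neg, inv_mul_cancel₀ (speed_pos hp hq hqm (h.mem x hx')).ne'] at hchain
  have hint := intervalIntegral.integral_eq_sub_of_hasDerivAt_of_le hr.2 hcont hderiv
    intervalIntegrable_const
  rw [intervalIntegral.integral_const, h.zero R le_rfl, travel_zero hqm, smul_eq_mul] at hint
  linarith

theorem radius_eq (hp : 1 < p) (hq : -1 < q) (hqp : q < p - 1) (hqm : q < m)
    (h : IsProfile p q m u R) : R = radius p q m := by
  rw [← travel_peak hp hq hqp hqm, ← h.origin,
    h.travel_eq hp hq hqp hqm (left_mem_Icc.2 h.radius_pos.le), sub_zero]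

theorem unique (hp : 1 < p) (hq : -1 < q) (hqp : q < p - 1) (hqm : q < m) {R' : ℝ} {v : ℝ → ℝ}
    (hu : IsProfile p q m u R) (hv : IsProfile p q m v R') : u = v := by
  obtain rfl : R = R' := (hu.radius_eq hp hq hqp hqm).trans (hv.radius_eq hp hq hqp hqm).symm
  funext x
  rw [hu.even, hv.even]
  rcases le_total |x| R with hx | hx
  · exact (strictMonoOn_travel hp hq hqp hqm).injOn (hu.mem_Icc hq hqm _) (hv.mem_Icc hq hqm _)
      ((hu.travel_eq hp hq hqp hqm ⟨abs_nonneg x, hx⟩).trans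
        (hv.travel_eq hp hq hqp hqm ⟨abs_nonneg x, hx⟩).symm)
  · rw [hu.zero _ hx, hv.zero _ hx]

theorem eq_incBetaInv (hp : 1 < p) (hq : -1 < q) (hqp : q < p - 1) (hqm : q < m)
    (h : IsProfile p q m u R) (hr : r ∈ Icc 0 R) :
    u r = ((m + 1) / (q + 1) * incBetaInv (cBar p q m * (R - r))
      ((p - 1 - q) / (p * (m - q))) (1 - 1 / p)) ^ (1 / (m - q)) := by
  have hM := peak_pos hq hqm
  have hur := h.mem_Icc hq hqm r
  rw [← h.travel_eq hp hq hqp hqm hr, travel, mul_div_cancel₀ _ (cBar_pos hp hq hqm).ne',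
    incBetaInv_incBeta (betaParam_pos (by linarith) hqp hqm) (one_sub_one_div_pos hp)
      (div_rpow_mem_Icc hM (sub_pos.2 hqm) hur), ← peak_rpow hq hqm,
    ← Real.mul_rpow hM.le (div_nonneg hur.1 hM.le), mul_div_cancel₀ _ hM.ne',
    ← Real.rpow_mul hur.1, mul_one_div_cancel (by linarith), Real.rpow_one]

end IsProfile

end Travel

section BestConstant

variable {p q m t : ℝ}

/-- The factor which the substitution `s = (t / peak)^(m - q)` splits off the integral of the
momentum, leaving a Beta integral. -/
noncomputable def actionScale (p q m : ℝ) : ℝ :=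
  (p / ((p - 1) * (q + 1))) ^ ((p - 1) / p) * peak q m ^ (eta2 p q / p) / (m - q)

lemma actionScale_pos (hp : 1 < p) (hq : -1 < q) (hqm : q < m) : 0 < actionScale p q m := by
  have hM := peak_pos hq hqm
  have hq1 : 0 < q + 1 := by linarith
  unfold actionScale
  positivity

lemma log_actionScale (hp : 1 < p) (hq : -1 < q) (hqm : q < m) :
    Real.log (actionScale p q m) =
      (p - 1) / p * (Real.log p - Real.log (p - 1) - Real.log (q + 1)) +
        eta2 p q / p * Real.log (peak q m) - Real.log (m - q) := by
  have hM := peak_pos hq hqm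
  have hp1 : 0 < p - 1 := by linarith
  have hq1 : 0 < q + 1 := by linarith
  have hmq : m - q ≠ 0 := by linarith
  rw [actionScale, Real.log_div (by positivity) hmq, Real.log_mul (by positivity) (by positivity),
    Real.log_rpow (by positivity), Real.log_rpow hM, Real.log_div (by positivity) (by positivity),
    Real.log_mul hp1.ne' hq1.ne', sub_sub]

lemma two_mul_sub_one_div_pos (hp : 1 < p) : 0 < (2 * p - 1) / p :=
  div_pos (by linarith) (by linarith)

lemma eta2_div_pos (hp : 1 < p) (hq : -1 < q) (hqm : q < m) : 0 < eta2 p q / (p * (m - q)) :=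
  div_pos (eta2_pos hp hq) (mul_pos (by linarith) (by linarith))

lemma momentum_eq_actionScale_mul (hp : 1 < p) (hq : -1 < q) (hqm : q < m)
    (ht : t ∈ Ioo 0 (peak q m)) :
    momentum p q m t = actionScale p q m *
      ((m - q) / peak q m * (t / peak q m) ^ ((m - q) * (eta2 p q / (p * (m - q))) - 1) *
        (1 - (t / peak q m) ^ (m - q)) ^ ((2 * p - 1) / p - 1)) := by
  have hM := peak_pos hq hqm
  have hp0 : 0 < p := by linarith
  have hp1 : 0 < p - 1 := by linarith
  have hq1 : 0 < q + 1 := by linarith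
  have hmq : 0 < m - q := by linarith
  have ht0 := ht.1
  have hK := actionScale_pos hp hq hqm
  have hs : 0 < 1 - (t / peak q m) ^ (m - q) := sub_pos.2 (div_rpow_mem_Ioo hM hmq ht).2
  rw [momentum_eq hq hqm ht0.le ht.2.le, potential_eq hq hqm ht0.le]
  refine Real.log_injOn_pos (mem_Ioi.2 (by positivity)) (mem_Ioi.2 (by positivity)) ?_
  rw [Real.log_rpow (by positivity), Real.log_mul (by positivity) (by positivity),
    Real.log_div hp0.ne' hp1.ne', Real.log_mul (by positivity) hs.ne',
    Real.log_div (by positivity) hq1.ne', Real.log_rpow ht0, Real.log_mul hK.ne' (by positivity),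
    log_actionScale hp hq hqm, Real.log_mul (by positivity) (by positivity),
    Real.log_mul (by positivity) (by positivity), Real.log_div hmq.ne' hM.ne',
    Real.log_rpow (by positivity), Real.log_rpow hs, Real.log_div ht0.ne' hM.ne']
  unfold eta2
  field_simp
  ring

lemma action_eq (hp : 1 < p) (hq : -1 < q) (hqm : q < m) :
    action p q m = 2 * (actionScale p q m *
      ProbabilityTheory.beta (eta2 p q / (p * (m - q))) ((2 * p - 1) / p)) := by
  have ha := eta2_div_pos hp hq hqm
  have hb := two_mul_sub_one_div_pos hp
  have hM := peak_pos hq hqm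
  have hmq : 0 < m - q := by linarith
  have hint := intervalIntegral.integral_eq_sub_of_hasDerivAt_of_le hM.le
    ((continuousOn_incBeta_div_rpow ha hb hM hmq).const_mul (actionScale p q m))
    (fun t ht => ((hasDerivAt_incBeta_div_rpow ha hb hM hmq ht).const_mul _).congr_deriv
      (momentum_eq_actionScale_mul hp hq hqm ht).symm)
    ((continuous_momentum hp hq hqm).intervalIntegrable _ _)
  rw [action, hint, div_self hM.ne', Real.one_rpow, incBeta_one ha hb, zero_div,
    Real.zero_rpow hmq.ne', incBeta_zero, mul_zero, sub_zero]

lemma log_action (hp : 1 < p) (hq : -1 < q) (hqm : q < m) :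
    Real.log (action p q m) = Real.log 2 + (Real.log (actionScale p q m) +
      Real.log (ProbabilityTheory.beta (eta2 p q / (p * (m - q))) ((2 * p - 1) / p))) := by
  have hB := ProbabilityTheory.beta_pos (eta2_div_pos hp hq hqm) (two_mul_sub_one_div_pos hp)
  have hK := actionScale_pos hp hq hqm
  rw [action_eq hp hq hqm, Real.log_mul two_ne_zero (by positivity), Real.log_mul hK.ne' hB.ne']

lemma nagyConstant_pos (hp : 1 < p) (hq : -1 < q) (hqm : q < m) : 0 < nagyConstant p q m := by
  have hB := ProbabilityTheory.beta_pos (eta2_div_pos hp hq hqm) (two_mul_sub_one_div_pos hp)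
  have he1 := eta1_pos hp (hq.trans hqm)
  have he2 := eta2_pos hp hq
  unfold nagyConstant
  positivity

lemma log_nagyConstant (hp : 1 < p) (hq : -1 < q) (hqm : q < m) :
    Real.log (nagyConstant p q m) = -ell p q m *
      (p * Real.log 2 + (1 - p) * Real.log (p - 1) +
        eta1 p m / (m - q) * Real.log (eta1 p m) - (2 * p - 1) * Real.log (m - q) -
        eta2 p q / (m - q) * Real.log (eta2 p q) +
        p * Real.log (ProbabilityTheory.beta (eta2 p q / (p * (m - q))) ((2 * p - 1) / p))) := by
  have hB := ProbabilityTheory.beta_pos (eta2_div_pos hp hq hqm) (two_mul_sub_one_div_pos hp)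
  have he1 := eta1_pos hp (hq.trans hqm)
  have he2 := eta2_pos hp hq
  have hp1 : 0 < p - 1 := by linarith
  have hmq : 0 < m - q := by linarith
  rw [nagyConstant, Real.log_rpow (by positivity), Real.log_mul (by positivity) (by positivity),
    Real.log_div (by positivity) (by positivity), Real.log_mul (by positivity) (by positivity),
    Real.log_mul (by positivity) (by positivity), Real.log_mul (by positivity) (by positivity),
    Real.log_rpow two_pos, Real.log_rpow hp1, Real.log_rpow he1, Real.log_rpow hmq,
    Real.log_rpow he2, Real.log_rpow hB]
  ring

theorem nagyConstant_eq (hp : 1 < p) (hq : -1 < q) (hqm : q < m) :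
    nagyConstant p q m = constOfAction p q m (action p q m) := by
  have hA := action_pos hp hq hqm
  have hp0 : p ≠ 0 := by linarith
  have hmq : m - q ≠ 0 := by linarith
  have hm1 : m + 1 ≠ 0 := by linarith
  have he2 := (eta2_pos hp hq).ne'
  refine Real.log_injOn_pos (mem_Ioi.2 (nagyConstant_pos hp hq hqm))
    (mem_Ioi.2 (constOfAction_pos hp hq hqm hA)) ?_
  rw [log_constOfAction hp hq hqm hA, log_action hp hq hqm, log_actionScale hp hq hqm,
    log_theta hp hq hqm, log_one_sub_theta hp hq hqm, log_peak hq hqm, log_nagyConstant hp hq hqm,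
    theta_eq, ell, ← eta2]
  generalize Real.log (eta1 p m) = logEta1, Real.log (eta2 p q) = logEta2,
    Real.log (ProbabilityTheory.beta _ _) = logBeta
  unfold eta1 eta2 at *
  field_simp
  ring

end BestConstant

section Extremality

lemma one_div_m_add_one_eq {p q m : ℝ} (hp : 1 < p) (hq : -1 < q) (hqm : q < m) :
    1 / (m + 1) = -theta p q m + (1 - theta p q m) / (q + 1) + theta p q m / p := by
  have hp0 : p ≠ 0 := by linarith
  have hq1 : q + 1 ≠ 0 := by linarith
  have hm1 : m + 1 ≠ 0 := by linarith
  have he2 := (eta2_pos hp hq).ne'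
  rw [one_sub_theta_eq hp hq hqm, theta_eq]
  unfold eta1 eta2 at *
  field_simp
  ring

lemma integral_eq_two_mul_of_even {f : ℝ → ℝ} {R : ℝ} (hR : 0 ≤ R) (heven : ∀ x, f x = f |x|)
    (hzero : ∀ r, R ≤ r → f r = 0) : ∫ x, f x = 2 * ∫ x in (0 : ℝ)..R, f x := by
  rw [integral_congr_ae (.of_forall heven), integral_comp_abs, intervalIntegral.integral_of_le hR,
    setIntegral_eq_of_subset_of_forall_sdiff_eq_zero measurableSet_Ioi Ioc_subset_Ioi_self]
  exact fun x hx => hzero x (le_of_not_ge fun hxR => hx.2 ⟨hx.1, hxR⟩)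

namespace IsProfile

variable {p q m R : ℝ} {u : ℝ → ℝ}

lemma continuous_rpow (h : IsProfile p q m u R) {k : ℝ} (hk : 0 ≤ k) :
    Continuous fun x => u x ^ k :=
  h.continuous.rpow_const fun _ => Or.inr hk

lemma integral_abs_rpow (hq : -1 < q) (hqm : q < m) (h : IsProfile p q m u R) (k : ℝ) :
    ∫ x, |u x| ^ k = ∫ x, u x ^ k :=
  integral_congr_ae (.of_forall fun x => by
    simp only [abs_of_nonneg (h.mem_Icc hq hqm x).1])

lemma integral_rpow_eq (h : IsProfile p q m u R) {k : ℝ} (hk : 0 < k) :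
    ∫ x, u x ^ k = 2 * ∫ x in (0 : ℝ)..R, u x ^ k :=
  integral_eq_two_mul_of_even h.radius_pos.le (fun x => by rw [← h.even])
    fun r hr => by rw [h.zero r hr, Real.zero_rpow hk.ne']

lemma continuous_speed_rpow (hp : 1 < p) (hq : -1 < q) (hqm : q < m) (h : IsProfile p q m u R) :
    Continuous fun x => speed p q m (u x) ^ p :=
  ((continuous_speed hp hq hqm).comp h.continuous).rpow_const fun _ => Or.inr (by linarith)

lemma integral_speed_rpow_eq (hp : 1 < p) (hq : -1 < q) (hqm : q < m) (h : IsProfile p q m u R) :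
    ∫ x, speed p q m (u x) ^ p = 2 * ∫ x in (0 : ℝ)..R, speed p q m (u x) ^ p :=
  integral_eq_two_mul_of_even h.radius_pos.le (fun x => by rw [← h.even]) fun r hr => by
    rw [h.zero r hr, speed_zero hp hq hqm, Real.zero_rpow (by linarith)]

lemma integral_speed_rpow_eq_action (hp : 1 < p) (hq : -1 < q) (hqm : q < m)
    (h : IsProfile p q m u R) : ∫ x, speed p q m (u x) ^ p = action p q m := by
  have hprim : ∀ r ∈ Ioo 0 R, HasDerivAt (fun r => ∫ t in (0 : ℝ)..u r, momentum p q m t)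
      (-speed p q m (u r) ^ p) r := fun r hr =>
    ((hasDerivAt_primitive_of_continuous (continuous_momentum hp hq hqm) 0 (u r)).comp r
      (h.hasDerivAt r hr)).congr_deriv
      (by rw [← speed_mul_momentum hp hq hqm (h.mem_Icc hq hqm r)]; ring)
  have hcont : Continuous fun r => ∫ t in (0 : ℝ)..u r, momentum p q m t :=
    (intervalIntegral.continuous_primitive (continuous_momentum hp hq hqm).intervalIntegrable
      0).comp h.continuous
  have hint := intervalIntegral.integral_eq_sub_of_hasDerivAt_of_le h.radius_pos.le
    hcont.continuousOn hprim ((h.continuous_speed_rpow hp hq hqm).neg.intervalIntegrable _ _)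
  rw [h.zero R le_rfl, h.origin, intervalIntegral.integral_same,
    intervalIntegral.integral_neg] at hint
  rw [h.integral_speed_rpow_eq hp hq hqm, action]
  linarith

lemma integral_abs_deriv_rpow (hp : 1 < p) (hq : -1 < q) (hqm : q < m)
    (h : IsProfile p q m u R) : ∫ x, |deriv u x| ^ p = action p q m := by
  simp_rw [h.abs_deriv hp hq hqm, h.integral_speed_rpow_eq_action hp hq hqm]

/-- The equation tested against the profile itself. -/
lemma action_add_integral_eq (hp : 1 < p) (hq : -1 < q) (hqm : q < m) (h : IsProfile p q m u R) :
    action p q m + ∫ x, u x ^ (q + 1) = ∫ x, u x ^ (m + 1) := by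
  have hspeed := (h.continuous_speed_rpow hp hq hqm).intervalIntegrable (μ := volume) 0 R
  have hQ := (h.continuous_rpow (k := q + 1) (by linarith)).intervalIntegrable (μ := volume) 0 R
  have hN := (h.continuous_rpow (k := m + 1) (by linarith)).intervalIntegrable (μ := volume) 0 R
  have hderiv : ∀ r ∈ Ioo 0 R, HasDerivAt (fun r => u r * -momentum p q m (u r))
      (speed p q m (u r) ^ p + u r ^ (q + 1) - u r ^ (m + 1)) r := fun r hr => by
    refine ((h.hasDerivAt r hr).mul (h.hasDerivAt_neg_momentum hp hq hqm hr)).congr_deriv ?_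
    have hur := (h.mem r hr).1.ne'
    rw [← speed_mul_momentum hp hq hqm (h.mem_Icc hq hqm r), Real.rpow_add_one hur,
      Real.rpow_add_one hur]
    ring
  have hcont : Continuous fun r => u r * -momentum p q m (u r) :=
    h.continuous.mul ((continuous_momentum hp hq hqm).comp h.continuous).neg
  have hint := intervalIntegral.integral_eq_sub_of_hasDerivAt_of_le h.radius_pos.le
    hcont.continuousOn hderiv ((hspeed.add hQ).sub hN)
  have hpeak : momentum p q m (peak q m) = 0 := by
    rw [momentum_eq_speed_rpow hp hq hqm (right_mem_Icc.2 (peak_pos hq hqm).le),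
      speed_peak hp hq hqm, Real.zero_rpow (by linarith)]
  rw [h.zero R le_rfl, h.origin, hpeak, neg_zero, zero_mul, mul_zero, sub_zero,
    intervalIntegral.integral_sub (hspeed.add hQ) hN,
    intervalIntegral.integral_add hspeed hQ] at hint
  rw [← h.integral_speed_rpow_eq_action hp hq hqm, h.integral_speed_rpow_eq hp hq hqm,
    h.integral_rpow_eq (by linarith), h.integral_rpow_eq (by linarith)]
  linarith

/-- Conservation of energy, integrated over the line. -/
lemma action_eq_integral_sub (hp : 1 < p) (hq : -1 < q) (hqm : q < m) (h : IsProfile p q m u R) :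
    action p q m = p / (p - 1) *
      ((∫ x, u x ^ (q + 1)) / (q + 1) - (∫ x, u x ^ (m + 1)) / (m + 1)) := by
  have henergy := ((h.memX hp hq hqm).integrable_momentum_rpow_and_integral_eq hp hq hqm
    h.continuous fun x => (abs_of_nonneg (h.mem_Icc hq hqm x).1).trans_le (h.mem_Icc hq hqm x).2).2
  rwa [h.integral_abs_rpow hq hqm, h.integral_abs_rpow hq hqm, integral_congr_ae (.of_forall
    fun x => momentum_rpow_eq_speed_rpow hp hq hqm (h.mem_Icc hq hqm x)),
    h.integral_speed_rpow_eq_action hp hq hqm] at henergy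

theorem integral_rpow_q_add_one (hp : 1 < p) (hq : -1 < q) (hqm : q < m)
    (h : IsProfile p q m u R) :
    ∫ x, u x ^ (q + 1) = action p q m * (1 - theta p q m) / theta p q m := by
  have hp0 : p ≠ 0 := by linarith
  have hp1 : p - 1 ≠ 0 := by linarith
  have hq1 : q + 1 ≠ 0 := by linarith
  have hmq : m - q ≠ 0 := by linarith
  have hm1 : m + 1 ≠ 0 := by linarith
  have he2 := (eta2_pos hp hq).ne'
  have henergy := h.action_eq_integral_sub hp hq hqm
  rw [← h.action_add_integral_eq hp hq hqm] at henergy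
  rw [one_sub_theta_eq hp hq hqm, theta_eq]
  field_simp at henergy ⊢
  unfold eta1
  linear_combination -henergy

theorem integral_rpow_m_add_one (hp : 1 < p) (hq : -1 < q) (hqm : q < m)
    (h : IsProfile p q m u R) :
    ∫ x, u x ^ (m + 1) = action p q m / theta p q m := by
  have hθ := (theta_pos hp hq hqm).ne'
  rw [← h.action_add_integral_eq hp hq hqm, h.integral_rpow_q_add_one hp hq hqm]
  field_simp
  ring

theorem integral_rpow_eq_constOfAction_mul (hp : 1 < p) (hq : -1 < q) (hqm : q < m)
    (h : IsProfile p q m u R) :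
    (∫ x, |u x| ^ (m + 1)) ^ (1 / (m + 1)) = constOfAction p q m (action p q m) *
      (∫ x, |u x| ^ (q + 1)) ^ ((1 - theta p q m) / (q + 1)) *
        (∫ x, |deriv u x| ^ p) ^ (theta p q m / p) := by
  have hA := action_pos hp hq hqm
  have hC := constOfAction_pos hp hq hqm hA
  have hθ := theta_pos hp hq hqm
  have hθ' := one_sub_theta_pos hp hq hqm
  rw [h.integral_abs_rpow hq hqm, h.integral_abs_rpow hq hqm, h.integral_rpow_q_add_one hp hq hqm,
    h.integral_rpow_m_add_one hp hq hqm, h.integral_abs_deriv_rpow hp hq hqm]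
  refine Real.log_injOn_pos (mem_Ioi.2 (by positivity)) (mem_Ioi.2 (by positivity)) ?_
  rw [Real.log_rpow (by positivity), Real.log_div hA.ne' hθ.ne',
    Real.log_mul (by positivity) (by positivity), Real.log_mul hC.ne' (by positivity),
    Real.log_rpow (by positivity), Real.log_rpow hA, Real.log_div (by positivity) hθ.ne',
    Real.log_mul hA.ne' hθ'.ne', log_constOfAction hp hq hqm hA,
    one_div_m_add_one_eq hp hq hqm]
  ring

lemma le_of_mem_gnConstants (hp : 1 < p) (hq : -1 < q) (hqm : q < m) (h : IsProfile p q m u R)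
    {C : ℝ} (hC : C ∈ gnConstants p q m) : constOfAction p q m (action p q m) ≤ C := by
  have hA := action_pos hp hq hqm
  have hθ := theta_pos hp hq hqm
  have hθ' := one_sub_theta_pos hp hq hqm
  have hX := h.memX hp hq hqm
  have hle := (hX.eLpNorm_le_iff_gnInequality hp hq hqm h.continuous hC.1).1 (hC.2 u (deriv u) hX)
  have hQ : 0 < ∫ x, |u x| ^ (q + 1) := by
    rw [h.integral_abs_rpow hq hqm, h.integral_rpow_q_add_one hp hq hqm]
    positivity
  have hD : 0 < ∫ x, |deriv u x| ^ p := by rwa [h.integral_abs_deriv_rpow hp hq hqm]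
  rw [GNInequality, h.integral_rpow_eq_constOfAction_mul hp hq hqm, mul_assoc, mul_assoc] at hle
  exact le_of_mul_le_mul_right hle (by positivity)

end IsProfile

theorem isLeast_nagyConstant {p q m : ℝ} (hp : 1 < p) (hq : -1 < q) (hqp : q < p - 1)
    (hqm : q < m) : IsLeast (gnConstants p q m) (nagyConstant p q m) := by
  rw [nagyConstant_eq hp hq hqm]
  exact ⟨constOfAction_mem_gnConstants hp hq hqm,
    fun C hC => (isProfile_height hp hq hqp hqm).le_of_mem_gnConstants hp hq hqm hC⟩

end Extremality

end NagyGN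

theorem theorem6p1_general (p q m : ℝ) (hp : 1 < p) (hq : -1 < q)
    (hqp : q < min (p - 1) m) :
    (∃! u : ℝ → ℝ, ∃ R : ℝ, NagyGN.IsFreeBoundarySolution p q m u R) ∧
    (∀ (u : ℝ → ℝ) (R : ℝ), NagyGN.IsFreeBoundarySolution p q m u R →
      R = NagyGN.radius p q m ∧
      (∀ r ∈ Set.Icc (0 : ℝ) R,
        u r = ((m + 1) / (q + 1) *
          NagyGN.incBetaInv (NagyGN.cBar p q m * (R - r))
            ((p - 1 - q) / (p * (m - q))) (1 - 1 / p)) ^ (1 / (m - q))) ∧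
      u 0 = ((m + 1) / (q + 1)) ^ (1 / (m - q)) ∧
      NagyGN.nagyConstant p q m =
        NagyGN.theta p q m ^ (-(NagyGN.theta p q m / p)) *
          (1 - NagyGN.theta p q m) ^ (NagyGN.theta p q m / p - 1 / (m + 1)) *
          (∫ x : ℝ, u x ^ (q + 1)) ^ (-NagyGN.theta p q m)) ∧
    IsLeast (NagyGN.gnConstants p q m) (NagyGN.nagyConstant p q m) := by
  obtain ⟨hqp, hqm⟩ := lt_min_iff.1 hqp
  refine ⟨?_, fun u R h => ?_, NagyGN.isLeast_nagyConstant hp hq hqp hqm⟩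
  · have hheight := NagyGN.isProfile_height hp hq hqp hqm
    refine ⟨_, ⟨_, hheight.isFreeBoundarySolution hp hq hqm⟩, ?_⟩
    rintro v ⟨R, hv⟩
    exact (hv.isProfile hp hq hqm).unique hp hq hqp hqm hheight
  · have hprofile := h.isProfile hp hq hqm
    refine ⟨hprofile.radius_eq hp hq hqp hqm, fun r hr => hprofile.eq_incBetaInv hp hq hqp hqm hr,
      hprofile.origin, ?_⟩
    rw [NagyGN.nagyConstant_eq hp hq hqm, hprofile.integral_rpow_q_add_one hp hq hqm,
      NagyGN.constOfAction]

theorem theorem6p1 (p q m : ℝ) (hp : 1 < p) (hq : 0 < q) (hqp : q < min (p - 1) m) :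
    (∃! u : ℝ → ℝ, ∃ R : ℝ, NagyGN.IsFreeBoundarySolution p q m u R) ∧
    (∀ (u : ℝ → ℝ) (R : ℝ), NagyGN.IsFreeBoundarySolution p q m u R →
      R = NagyGN.radius p q m ∧
      (∀ r ∈ Set.Icc (0 : ℝ) R,
        u r = ((m + 1) / (q + 1) *
          NagyGN.incBetaInv (NagyGN.cBar p q m * (R - r))
            ((p - 1 - q) / (p * (m - q))) (1 - 1 / p)) ^ (1 / (m - q))) ∧
      u 0 = ((m + 1) / (q + 1)) ^ (1 / (m - q)) ∧
      NagyGN.nagyConstant p q m =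
        NagyGN.theta p q m ^ (-(NagyGN.theta p q m / p)) *
          (1 - NagyGN.theta p q m) ^ (NagyGN.theta p q m / p - 1 / (m + 1)) *
          (∫ x : ℝ, u x ^ (q + 1)) ^ (-NagyGN.theta p q m)) ∧
    IsLeast (NagyGN.gnConstants p q m) (NagyGN.nagyConstant p q m) :=
  theorem6p1_general p q m hp (by linarith) hqp
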